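/- Let $a<b$ be real numbers, let $\psi\in C^1[a,b]$ with $\psi'>0$ on $[a,b]$, and write $\psi_a=\psi(a)$, $\psi_b=\psi(b)$, $\kappa=2/(\psi_b-\psi_a)$. For $\alpha,\beta>-1$ let $$\varpi^{\alpha,\beta}(x)=\kappa^{\alpha+\beta+1}(\psi_b-\psi(x))^{\alpha}(\psi(x)-\psi_a)^{\beta}\psi'(x),\qquad \|f\|_{\varpi^{\alpha,\beta}}=\Big(\int_a^b f^2\,\varpi^{\alpha,\beta}\,dx\Big)^{1/2},$$ and let $L^2_{\varpi^{\alpha,\beta}}(a,b)$ be the corresponding weighted space of real functions, with inner product $(f,g)_{\varpi^{\alpha,\beta}}=\int_a^b fg\,\varpi^{\alpha,\beta}\,dx$. Let $\delta_\psi f=f'/\psi'$ and $\delta_\psi^n=\delta_\psi(\delta_\psi^{n-1})$, $\delta_\psi^0f=f$, with derivatives taken in the weak sense on $(a,b)$. For $\mu>0$ let $${}_\psi D_{a,x}^{-\mu}f(x)=\frac1{\Gamma(\mu)}\int_a^x\psi'(\tau)(\psi(x)-\psi(\tau))^{\mu-1}f(\tau)\,d\tau ,$$ and for $n-1<\mu<n$,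 $n\in\mathbb N^+$, let ${}_\psi D_{a,x}^{\mu}f=\delta_\psi^n\big[{}_\psi D_{a,x}^{-(n-\mu)}f\big]$. Let $$B^m_{0,0}(a,b)=\{v:\ \delta_\psi^k v\in L^2_{\varpi^{k,k}}(a,b),\ 0\le k\le m\},\qquad F_N^\psi=\mathrm{span}\{1,\psi,\dots,\psi^N\}.$$ Let $0<\rho<1$, and for $u\in L^2_{\varpi^{\rho,\rho}}(a,b)$ let $\widetilde P_Nu$ be the orthogonal projection of $u$ onto $E_N=(\psi-\psi_a)^{-\rho}F_N^\psi$ in $L^2_{\varpi^{\rho,\rho}}(a,b)$, that is, the unique element of $E_N$ with $(u-\widetilde P_Nu,v)_{\varpi^{\rho,\rho}}=0$ for all $v\in E_N$. Let $l,m$ be integers with $1\le l\le m$. Then there is a constant $C>0$, which may depend on $a,b,\psi,\rho,l,m$ but not on $N$ or $u$, such that for every integer $N\ge0$ with $m\le N+1$ and every $u\in L^2_{\varpi^{\rho,\rho}}(a,b)$ with ${}_\psi D_{a,x}^{-\rho}u\in B^m_{0,0}(a,b)$, the projection $\widetilde P_Nu$ is well defined, ${}_\psi D_{a,x}^{l-\rho}(u-\widetilde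 P_Nu)$ exists and belongs to $L^2_{\varpi^{l,l}}(a,b)$, and $$\big\|{}_\psi D_{a,x}^{l-\rho}(u-\widetilde P_Nu)\big\|_{\varpi^{l,l}}\le C\,N^{l-m}\,\big\|{}_\psi D_{a,x}^{m-\rho}u\big\|_{\varpi^{m,m}}$$ (with $0^0=1$ in the case $N=0$, $l=m=1$). -/

import Mathlib

open MeasureTheory Set

noncomputable section

namespace PsiSpectral

/-- The scaling factor `κ = 2 / (ψ(b) - ψ(a))`. -/
def kappa (ψ : ℝ → ℝ) (a b : ℝ) : ℝ := 2 / (ψ b - ψ a)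

/-- The mapped Jacobi weight
`ϖ^{α,β}(x) = κ^{α+β+1} (ψ(b) - ψ(x))^α (ψ(x) - ψ(a))^β ψ'(x)`, for `x ∈ (a, b)`. -/
def weight (ψ : ℝ → ℝ) (a b α β x : ℝ) : ℝ :=
  kappa ψ a b ^ (α + β + 1) * (ψ b - ψ x) ^ α * (ψ x - ψ a) ^ β * deriv ψ x

/-- The measure `ϖ^{α,β}(x) dx` on `(a, b)`; thus `L²_{ϖ^{α,β}}(a,b)` consists of the `f` with
`MemLp f 2 (weightMeasure ψ a b α β)`. -/
def weightMeasure (ψ : ℝ → ℝ) (a b α β : ℝ) : Measure ℝ :=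
  (volume.restrict (Ioo a b)).withDensity fun x => ENNReal.ofReal (weight ψ a b α β x)

/-- The norm `‖f‖_{ϖ^{α,β}} = (∫_a^b f² ϖ^{α,β} dx)^{1/2}` of an `f` in `L²_{ϖ^{α,β}}(a,b)`. -/
def weightNorm (ψ : ℝ → ℝ) (a b α β : ℝ) (f : ℝ → ℝ) : ℝ :=
  Real.sqrt (∫ x, f x ^ 2 ∂(weightMeasure ψ a b α β))

/-- The left-sided `ψ`-fractional integral of order `μ > 0`:
`(1 / Γ(μ)) ∫_a^x ψ'(τ) (ψ(x) - ψ(τ))^{μ-1} f(τ) dτ`. -/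
def psiIntegral (ψ : ℝ → ℝ) (a μ : ℝ) (f : ℝ → ℝ) (x : ℝ) : ℝ :=
  1 / Real.Gamma μ * ∫ τ in a..x, deriv ψ τ * (ψ x - ψ τ) ^ (μ - 1) * f τ

/-- `g = δ_ψ f = f' / ψ'` on `(a, b)` in the weak sense. Since `(δ_ψ φ) dψ = φ' dx`, the identity
`∫ f (δ_ψ φ) dψ = - ∫ g φ dψ` reads `∫ f φ' dx = - ∫ g φ ψ' dx`. The test functions are the
`C¹` functions with compact support in `(a, b)`. -/
def IsWeakDelta (ψ : ℝ → ℝ) (a b : ℝ) (f g : ℝ → ℝ) : Prop :=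
  LocallyIntegrableOn f (Ioo a b) ∧ LocallyIntegrableOn g (Ioo a b) ∧
    ∀ φ : ℝ → ℝ, ContDiff ℝ 1 φ → HasCompactSupport φ → tsupport φ ⊆ Ioo a b →
      ∫ x in a..b, f x * deriv φ x = - ∫ x in a..b, g x * φ x * deriv ψ x

/-- `g = δ_ψ^n f` on `(a, b)` in the weak sense, through `δ_ψ^n = δ_ψ (δ_ψ^{n-1})`. -/
def IsWeakDeltaPow (ψ : ℝ → ℝ) (a b : ℝ) : ℕ → (ℝ → ℝ) → (ℝ → ℝ) → Prop
  | 0, f, g => f =ᵐ[volume.restrict (Ioo a b)] g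
  | n + 1, f, g => ∃ h : ℝ → ℝ, IsWeakDeltaPow ψ a b n f h ∧ IsWeakDelta ψ a b h g

/-- `g` is the left-sided `ψ`-Riemann-Liouville derivative of `f` of non-integer order `μ > 0`:
`g = δ_ψ^n` of the `ψ`-fractional integral of `f` of order `n - μ`, where `n - 1 < μ < n`,
that is, `n = ⌈μ⌉`. -/
def IsPsiDeriv (ψ : ℝ → ℝ) (a b μ : ℝ) (f g : ℝ → ℝ) : Prop :=
  IsWeakDeltaPow ψ a b ⌈μ⌉₊ (psiIntegral ψ a ((⌈μ⌉₊ : ℝ) - μ) f) g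

/-- The mapped Jacobi-weighted Sobolev space `B^m_{α,β}(a,b)`: all `v` with
`δ_ψ^k v ∈ L²_{ϖ^{α+k,β+k}}(a,b)` for `0 ≤ k ≤ m`. -/
def SobolevB (ψ : ℝ → ℝ) (a b : ℝ) (m : ℕ) (α β : ℝ) : Set (ℝ → ℝ) :=
  {v | ∀ k ≤ m, ∃ g : ℝ → ℝ, IsWeakDeltaPow ψ a b k v g ∧
    MemLp g 2 (weightMeasure ψ a b (α + k) (β + k))}

/-- `F_N^ψ = span {1, ψ, ψ², …, ψ^N}`. -/
def spaceF (ψ : ℝ → ℝ) (N : ℕ) : Submodule ℝ (ℝ → ℝ) :=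
  Submodule.span ℝ ((fun (i : ℕ) (x : ℝ) => ψ x ^ i) '' {i | i ≤ N})

/-- `E_N^{ρ,ψ} = (ψ - ψ(a))^{-ρ} F_N^ψ`. -/
def spaceE (ψ : ℝ → ℝ) (a ρ : ℝ) (N : ℕ) : Set (ℝ → ℝ) :=
  {v | ∃ φ ∈ spaceF ψ N, v = fun x => (ψ x - ψ a) ^ (-ρ) * φ x}

/-- `p` is the orthogonal projection of `u` onto `E_N^{ρ,ψ}` in `L²_{ϖ^{ρ,ρ}}(a,b)`. -/
def IsProjE (ψ : ℝ → ℝ) (a b ρ : ℝ) (N : ℕ) (u p : ℝ → ℝ) : Prop :=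
  p ∈ spaceE ψ a ρ N ∧
    ∀ v ∈ spaceE ψ a ρ N, ∫ x, (u x - p x) * v x ∂(weightMeasure ψ a b ρ ρ) = 0

end PsiSpectral

end

/-! Write `I^ρ` for the `ψ`-fractional integral of order `ρ` and `W = (ψ(b) - X)(X - ψ(a))`. Since
`0 < ρ < 1`, the derivative of order `k - ρ` is `δ_ψ^k I^ρ` for every integer `k ≥ 1`, so the claim
concerns integer derivatives of `v = I^ρ u` and of `I^ρ (u - p)`, where `p` is the projection.

The projection becomes a Legendre projection under `I^ρ`. On one side, `I^ρ` sends `(ψ - ψ(a))^{-ρ}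
P(ψ)` to a polynomial in `ψ` of no larger degree (`exists_psiIntegral_poly`). On the other side, its
adjoint for `dψ` sends `Q(ψ)` to a multiple of `(ψ(b) - ψ)^ρ R(ψ)` with `deg R` at most the bound on
`deg Q` (`exists_integral_psiIntegral`), and this is, up to a constant, an element of `E_N` times
the weight `ϖ^{ρ,ρ}` taken relative to `dψ`. Hence orthogonality of `u - p` to `E_N` says that `I^ρ
(u - p) = v - q(ψ)` with `deg q ≤ N` and that this is orthogonal for `dψ` to all polynomials in `ψ`
of degree at most `N` (`psiIntegral_sub_isProjE`).

For the Legendre projection everything is diagonal. The operator `(-1)^k D^k W^k D^k` is symmetric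
and does not raise degrees, so each Legendre polynomial `L_n` is an eigenvector, with eigenvalue
`λ_{k,n} = (n+k)!/(n-k)!` for `n ≥ k` and `0` otherwise (`legendreOp_legendrePoly`). Consequently
the `D^k L_n` are orthogonal in `L²_{ϖ^{k,k}}` with squared norms proportional to `λ_{k,n} ‖L_n‖²`,
and the coefficient of `δ_ψ^k f` along `D^k L_n` is the coefficient of `f` along `L_n`. This uses
`k` integrations by parts without boundary terms (`integral_chain_mul_eval`). Parseval at order `l`
and Bessel at order `m` (`norm_sq_le_of_orthogonal_expansions`) leave the bound of `λ_{l,n} /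
λ_{m,n}` over `n > N`, which is of order `N^{2(l-m)}` (`pow_mul_legendreEig_le`). -/

noncomputable section

/-! ### The change of variables `t = ψ(x)`. -/

namespace PsiSpectral

/-- A `C¹` function on `[a, b]` with positive derivative. -/
structure IsScale (ψ : ℝ → ℝ) (a b : ℝ) : Prop where
  lt : a < b
  contDiffOn : ContDiffOn ℝ 1 ψ (Icc a b)
  pos : ∀ x ∈ Icc a b, 0 < derivWithin ψ (Icc a b) x

namespace IsScale

variable {ψ : ℝ → ℝ} {a b : ℝ}

lemma continuousOn (h : IsScale ψ a b) : ContinuousOn ψ (Icc a b) := h.contDiffOn.continuousOn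

lemma contDiffAt (h : IsScale ψ a b) {x : ℝ} (hx : x ∈ Ioo a b) : ContDiffAt ℝ 1 ψ x :=
  h.contDiffOn.contDiffAt (Icc_mem_nhds hx.1 hx.2)

lemma hasDerivAt (h : IsScale ψ a b) {x : ℝ} (hx : x ∈ Ioo a b) : HasDerivAt ψ (deriv ψ x) x :=
  ((h.contDiffAt hx).differentiableAt (by norm_num)).hasDerivAt

lemma derivWithin_eq {x : ℝ} (hx : x ∈ Ioo a b) :
    derivWithin ψ (Icc a b) x = deriv ψ x :=
  derivWithin_of_mem_nhds (Icc_mem_nhds hx.1 hx.2)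

lemma deriv_pos (h : IsScale ψ a b) {x : ℝ} (hx : x ∈ Ioo a b) : 0 < deriv ψ x := by
  rw [← derivWithin_eq hx]; exact h.pos x (Ioo_subset_Icc_self hx)

lemma continuousOn_derivWithin (h : IsScale ψ a b) :
    ContinuousOn (derivWithin ψ (Icc a b)) (Icc a b) :=
  h.contDiffOn.continuousOn_derivWithin (uniqueDiffOn_Icc h.lt) (by norm_num)

lemma continuousOn_deriv (h : IsScale ψ a b) : ContinuousOn (deriv ψ) (Ioo a b) :=
  (h.continuousOn_derivWithin.mono Ioo_subset_Icc_self).congr fun _ hx => (derivWithin_eq hx).symm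

lemma integrableOn_deriv (h : IsScale ψ a b) : IntegrableOn (deriv ψ) (Ioo a b) := by
  have : IntegrableOn (derivWithin ψ (Icc a b)) (Ioo a b) :=
    (h.continuousOn_derivWithin.integrableOn_compact isCompact_Icc).mono_set Ioo_subset_Icc_self
  exact this.congr_fun (fun x hx => derivWithin_eq hx) measurableSet_Ioo

lemma strictMonoOn (h : IsScale ψ a b) : StrictMonoOn ψ (Icc a b) := by
  apply strictMonoOn_of_deriv_pos (convex_Icc a b) h.continuousOn
  intro x hx
  rw [interior_Icc] at hx
  exact h.deriv_pos hx

lemma left_lt (h : IsScale ψ a b) {x : ℝ} (hx : x ∈ Ioo a b) : ψ a < ψ x :=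
  h.strictMonoOn (left_mem_Icc.2 h.lt.le) (Ioo_subset_Icc_self hx) hx.1

lemma lt_right (h : IsScale ψ a b) {x : ℝ} (hx : x ∈ Ioo a b) : ψ x < ψ b :=
  h.strictMonoOn (Ioo_subset_Icc_self hx) (right_mem_Icc.2 h.lt.le) hx.2

lemma left_lt_right (h : IsScale ψ a b) : ψ a < ψ b :=
  h.strictMonoOn (left_mem_Icc.2 h.lt.le) (right_mem_Icc.2 h.lt.le) h.lt

lemma kappa_pos (h : IsScale ψ a b) : 0 < kappa ψ a b :=
  div_pos two_pos (sub_pos.2 h.left_lt_right)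

lemma image_Ioo (h : IsScale ψ a b) {c d : ℝ} (hc : a ≤ c) (hcd : c ≤ d) (hd : d ≤ b) :
    ψ '' Ioo c d = Ioo (ψ c) (ψ d) := by
  have hsub : Icc c d ⊆ Icc a b := Icc_subset_Icc hc hd
  apply Subset.antisymm
  · rintro _ ⟨x, hx, rfl⟩
    exact ⟨h.strictMonoOn (hsub (left_mem_Icc.2 hcd)) (hsub (Ioo_subset_Icc_self hx)) hx.1,
      h.strictMonoOn (hsub (Ioo_subset_Icc_self hx)) (hsub (right_mem_Icc.2 hcd)) hx.2⟩
  · exact intermediate_value_Ioo hcd (h.continuousOn.mono hsub)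

lemma integral_comp (h : IsScale ψ a b) {c d : ℝ} (hc : a ≤ c) (hcd : c ≤ d) (hd : d ≤ b)
    (g : ℝ → ℝ) :
    ∫ x in Ioo c d, g (ψ x) * deriv ψ x = ∫ t in Ioo (ψ c) (ψ d), g t := by
  have hsub : Ioo c d ⊆ Ioo a b := Ioo_subset_Ioo hc hd
  rw [← h.image_Ioo hc hcd hd, integral_image_eq_integral_abs_deriv_smul measurableSet_Ioo
    (fun x hx => (h.hasDerivAt (hsub hx)).hasDerivWithinAt)
    (h.strictMonoOn.injOn.mono (hsub.trans Ioo_subset_Icc_self))]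
  refine setIntegral_congr_fun measurableSet_Ioo fun x hx => ?_
  simp only [abs_of_pos (h.deriv_pos (hsub hx)), smul_eq_mul, mul_comm]

lemma integrableOn_comp (h : IsScale ψ a b) {c d : ℝ} (hc : a ≤ c) (hcd : c ≤ d) (hd : d ≤ b)
    {g : ℝ → ℝ} (hg : IntegrableOn g (Ioo (ψ c) (ψ d))) :
    IntegrableOn (fun x => g (ψ x) * deriv ψ x) (Ioo c d) := by
  have hsub : Ioo c d ⊆ Ioo a b := Ioo_subset_Ioo hc hd
  rw [← h.image_Ioo hc hcd hd, integrableOn_image_iff_integrableOn_abs_deriv_smul measurableSet_Ioo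
    (fun x hx => (h.hasDerivAt (hsub hx)).hasDerivWithinAt)
    (h.strictMonoOn.injOn.mono (hsub.trans Ioo_subset_Icc_self))] at hg
  refine hg.congr_fun (fun x hx => ?_) measurableSet_Ioo
  simp only [abs_of_pos (h.deriv_pos (hsub hx)), smul_eq_mul, mul_comm]

end IsScale

/-! ### Beta integrals on an interval. -/

lemma integrableOn_beta_unit {α β : ℝ} (hα : -1 < α) (hβ : -1 < β) :
    IntegrableOn (fun s : ℝ => (1 - s) ^ α * s ^ β) (Ioo 0 1) := by
  have h := Complex.betaIntegral_convergent (u := ((β + 1 : ℝ) : ℂ)) (v := ((α + 1 : ℝ) : ℂ))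
    (by simp; linarith) (by simp; linarith)
  rw [intervalIntegrable_iff_integrableOn_Ioo_of_le zero_le_one] at h
  -- The modulus of the complex Beta integrand is the real integrand.
  refine IntegrableOn.congr_fun (f := fun x : ℝ => ‖(x : ℂ) ^ (((β + 1 : ℝ) : ℂ) - 1)
    * (1 - (x : ℂ)) ^ (((α + 1 : ℝ) : ℂ) - 1)‖) h.norm (fun x hx => ?_) measurableSet_Ioo
  have h1 : (1 - (x : ℂ)) = ((1 - x : ℝ) : ℂ) := by push_cast; ring
  simp only [norm_mul]
  rw [h1, Complex.norm_cpow_eq_rpow_re_of_pos hx.1,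
    Complex.norm_cpow_eq_rpow_re_of_pos (sub_pos.2 hx.2)]
  simp [mul_comm]

lemma beta_integrand_scale {c d α β s : ℝ} (hcd : c < d) (hs : s ∈ Ioo (0 : ℝ) 1) :
    (d - ((d - c) * s + c)) ^ α * ((d - c) * s + c - c) ^ β
      = (d - c) ^ (α + β) * ((1 - s) ^ α * s ^ β) := by
  have h : 0 < d - c := sub_pos.2 hcd
  rw [show d - ((d - c) * s + c) = (d - c) * (1 - s) by ring,
    show (d - c) * s + c - c = (d - c) * s by ring,
    Real.mul_rpow h.le (sub_pos.2 hs.2).le, Real.mul_rpow h.le hs.1.le, Real.rpow_add h]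
  ring

lemma integrableOn_beta {c d α β : ℝ} (hcd : c < d) (hα : -1 < α) (hβ : -1 < β) :
    IntegrableOn (fun t : ℝ => (d - t) ^ α * (t - c) ^ β) (Ioo c d) := by
  have h : 0 < d - c := sub_pos.2 hcd
  have him : (fun s => (d - c) * s + c) '' Ioo 0 1 = Ioo c d := by
    rw [image_affine_Ioo h]; simp
  rw [← him, integrableOn_image_iff_integrableOn_abs_deriv_smul (f' := fun _ => d - c)
    measurableSet_Ioo (fun x _ => by
      simpa using (((hasDerivAt_id x).const_mul (d - c)).add_const c).hasDerivWithinAt)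
    (fun x _ y _ hxy => by
      have : (d - c) * x + c = (d - c) * y + c := hxy
      exact mul_left_cancel₀ h.ne' (add_right_cancel this))]
  refine IntegrableOn.congr_fun (((integrableOn_beta_unit hα hβ).const_mul
    ((d - c) ^ (α + β))).const_mul (|d - c|)) (fun s hs => ?_) measurableSet_Ioo
  simp only [smul_eq_mul, beta_integrand_scale hcd hs]

lemma integral_beta_scale {c d α β : ℝ} (hcd : c < d) :
    ∫ t in Ioo c d, (d - t) ^ α * (t - c) ^ β
      = (d - c) ^ (α + β + 1) * ∫ s in Ioo (0 : ℝ) 1, (1 - s) ^ α * s ^ β := by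
  have h : 0 < d - c := sub_pos.2 hcd
  have him : (fun s => (d - c) * s + c) '' Ioo 0 1 = Ioo c d := by
    rw [image_affine_Ioo h]; simp
  rw [← him, integral_image_eq_integral_abs_deriv_smul (f' := fun _ => d - c)
    measurableSet_Ioo (fun x _ => by
      simpa using (((hasDerivAt_id x).const_mul (d - c)).add_const c).hasDerivWithinAt)
    (fun x _ y _ hxy => by
      have : (d - c) * x + c = (d - c) * y + c := hxy
      exact mul_left_cancel₀ h.ne' (add_right_cancel this)), ← integral_const_mul]
  refine setIntegral_congr_fun measurableSet_Ioo fun s hs => ?_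
  simp only [smul_eq_mul, beta_integrand_scale hcd hs, abs_of_pos h]
  rw [Real.rpow_add_one h.ne']
  ring

/-! ### The weighted measures. -/

namespace IsScale

variable {ψ : ℝ → ℝ} {a b : ℝ}

lemma aestronglyMeasurable (h : IsScale ψ a b) :
    AEStronglyMeasurable ψ (volume.restrict (Ioo a b)) :=
  (h.continuousOn.mono Ioo_subset_Icc_self).aestronglyMeasurable measurableSet_Ioo

lemma aestronglyMeasurable_deriv (h : IsScale ψ a b) :
    AEStronglyMeasurable (deriv ψ) (volume.restrict (Ioo a b)) :=
  h.continuousOn_deriv.aestronglyMeasurable measurableSet_Ioo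

lemma weight_pos (h : IsScale ψ a b) (α β : ℝ) {x : ℝ} (hx : x ∈ Ioo a b) :
    0 < weight ψ a b α β x := by
  have h1 := h.left_lt hx
  have h2 := h.lt_right hx
  exact mul_pos (mul_pos (mul_pos (Real.rpow_pos_of_pos h.kappa_pos _)
    (Real.rpow_pos_of_pos (by linarith) _)) (Real.rpow_pos_of_pos (by linarith) _)) (h.deriv_pos hx)

lemma aestronglyMeasurable_weight (h : IsScale ψ a b) (α β : ℝ) :
    AEStronglyMeasurable (weight ψ a b α β) (volume.restrict (Ioo a b)) := by
  have h1 := h.aestronglyMeasurable.aemeasurable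
  have h2 := h.aestronglyMeasurable_deriv.aemeasurable
  exact AEMeasurable.aestronglyMeasurable (by unfold weight; fun_prop)

lemma aemeasurable_ofReal_weight (h : IsScale ψ a b) (α β : ℝ) :
    AEMeasurable (fun x => ENNReal.ofReal (weight ψ a b α β x)) (volume.restrict (Ioo a b)) :=
  (h.aestronglyMeasurable_weight α β).aemeasurable.ennreal_ofReal

lemma ae_weightMeasure_iff (h : IsScale ψ a b) (α β : ℝ) {p : ℝ → Prop} :
    (∀ᵐ x ∂weightMeasure ψ a b α β, p x) ↔ ∀ᵐ x ∂volume.restrict (Ioo a b), p x := by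
  constructor
  · intro hp
    refine (withDensity_absolutelyContinuous' (h.aemeasurable_ofReal_weight α β) ?_).ae_le hp
    filter_upwards [ae_restrict_mem measurableSet_Ioo] with x hx
    simpa using h.weight_pos α β hx
  · intro hp
    exact (withDensity_absolutelyContinuous _ _).ae_le hp

lemma aestronglyMeasurable_weightMeasure_iff (h : IsScale ψ a b) (α β : ℝ) {f : ℝ → ℝ} :
    AEStronglyMeasurable f (weightMeasure ψ a b α β)
      ↔ AEStronglyMeasurable f (volume.restrict (Ioo a b)) := by
  constructor
  · intro hf
    refine hf.mono_ac (withDensity_absolutelyContinuous' (h.aemeasurable_ofReal_weight α β) ?_)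
    filter_upwards [ae_restrict_mem measurableSet_Ioo] with x hx
    simpa using h.weight_pos α β hx
  · intro hf
    exact hf.mono_ac (withDensity_absolutelyContinuous _ _)

lemma integral_weightMeasure (h : IsScale ψ a b) (α β : ℝ) (f : ℝ → ℝ) :
    ∫ x, f x ∂weightMeasure ψ a b α β = ∫ x in Ioo a b, weight ψ a b α β x * f x := by
  rw [weightMeasure, integral_withDensity_eq_integral_toReal_smul₀
    (h.aemeasurable_ofReal_weight α β) (by simp)]
  refine setIntegral_congr_fun measurableSet_Ioo fun x hx => ?_
  simp only [ENNReal.toReal_ofReal (h.weight_pos α β hx).le, smul_eq_mul]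

lemma integrable_weightMeasure_iff (h : IsScale ψ a b) (α β : ℝ) {f : ℝ → ℝ} :
    Integrable f (weightMeasure ψ a b α β)
      ↔ IntegrableOn (fun x => weight ψ a b α β x * f x) (Ioo a b) := by
  rw [weightMeasure, integrable_withDensity_iff_integrable_smul₀'
    (h.aemeasurable_ofReal_weight α β) (by simp)]
  refine integrable_congr ?_
  filter_upwards [ae_restrict_mem measurableSet_Ioo] with x hx
  simp only [ENNReal.toReal_ofReal (h.weight_pos α β hx).le, smul_eq_mul]

lemma memLp_weightMeasure_iff (h : IsScale ψ a b) (α β : ℝ) {f : ℝ → ℝ} :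
    MemLp f 2 (weightMeasure ψ a b α β) ↔ AEStronglyMeasurable f (volume.restrict (Ioo a b)) ∧
      IntegrableOn (fun x => weight ψ a b α β x * f x ^ 2) (Ioo a b) := by
  rw [← h.integrable_weightMeasure_iff, ← h.aestronglyMeasurable_weightMeasure_iff α β]
  exact ⟨fun hf => ⟨hf.1, (memLp_two_iff_integrable_sq hf.1).1 hf⟩,
    fun hf => (memLp_two_iff_integrable_sq hf.1).2 hf.2⟩

lemma integrableOn_weight (h : IsScale ψ a b) {α β : ℝ} (hα : -1 < α) (hβ : -1 < β) :
    IntegrableOn (weight ψ a b α β) (Ioo a b) := by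
  refine IntegrableOn.congr_fun ((h.integrableOn_comp le_rfl h.lt.le le_rfl
    (integrableOn_beta h.left_lt_right hα hβ)).const_mul (kappa ψ a b ^ (α + β + 1)))
    (fun x _ => ?_) measurableSet_Ioo
  simp only [weight]; ring

lemma isFiniteMeasure_weightMeasure (h : IsScale ψ a b) {α β : ℝ} (hα : -1 < α) (hβ : -1 < β) :
    IsFiniteMeasure (weightMeasure ψ a b α β) := by
  have : Integrable (fun _ : ℝ => (1 : ℝ)) (weightMeasure ψ a b α β) := by
    rw [h.integrable_weightMeasure_iff]
    simpa using h.integrableOn_weight hα hβ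
  exact (integrable_const_iff_isFiniteMeasure one_ne_zero).1 this

lemma integrableOn_mul_of_memLp (h : IsScale ψ a b) {α β : ℝ} {f g : ℝ → ℝ}
    (hf : MemLp f 2 (weightMeasure ψ a b α β)) (hg : MemLp g 2 (weightMeasure ψ a b α β)) :
    IntegrableOn (fun x => weight ψ a b α β x * (f x * g x)) (Ioo a b) :=
  (h.integrable_weightMeasure_iff α β).1 (hf.integrable_mul hg)

end IsScale

end PsiSpectral

end

noncomputable section

namespace PsiSpectral

open Polynomial Filter Topology

/-! ### Weak `δ_ψ`-derivatives: uniqueness and the case of polynomials in `ψ`. -/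

section WeakDelta

variable {ψ : ℝ → ℝ} {a b : ℝ}

lemma locallyIntegrableOn_congr {s : Set ℝ} {f g : ℝ → ℝ}
    (hfg : f =ᵐ[volume.restrict s] g) (hf : LocallyIntegrableOn f s) : LocallyIntegrableOn g s := by
  intro x hx
  obtain ⟨t, ht, hft⟩ := hf x hx
  refine ⟨t ∩ s, inter_mem ht self_mem_nhdsWithin, ?_⟩
  exact (hft.mono_set inter_subset_left).congr_fun_ae
    (ae_restrict_of_ae_restrict_of_subset inter_subset_right hfg)

lemma locallyIntegrableOn_sub {s : Set ℝ} {f g : ℝ → ℝ}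
    (hf : LocallyIntegrableOn f s) (hg : LocallyIntegrableOn g s) :
    LocallyIntegrableOn (fun x => f x - g x) s := by
  intro x hx
  exact (hf x hx).sub (hg x hx)

lemma integrableOn_mul_of_compact_support {f c : ℝ → ℝ} {K : Set ℝ}
    (hf : LocallyIntegrableOn f (Ioo a b)) (hc : ContinuousOn c (Ioo a b)) (hK : IsCompact K)
    (hKs : K ⊆ Ioo a b) (h0 : ∀ x ∉ K, c x = 0) :
    IntegrableOn (fun x => f x * c x) (Ioo a b) := by
  have h1 := (hf.mul_continuousOn hc isOpen_Ioo.isLocallyClosed).integrableOn_compact_subset hKs hK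
  exact h1.of_forall_sdiff_eq_zero measurableSet_Ioo fun x hx => by simp [h0 x hx.2]

lemma IsScale.intervalIntegral_eq (h : IsScale ψ a b) (f : ℝ → ℝ) :
    ∫ x in a..b, f x = ∫ x in Ioo a b, f x := by
  rw [intervalIntegral.integral_of_le h.lt.le, integral_Ioc_eq_integral_Ioo]

lemma IsWeakDelta.congr (h : IsScale ψ a b) {f f' g g' : ℝ → ℝ}
    (hf : f =ᵐ[volume.restrict (Ioo a b)] f') (hg : g =ᵐ[volume.restrict (Ioo a b)] g')
    (hfg : IsWeakDelta ψ a b f g) : IsWeakDelta ψ a b f' g' := by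
  refine ⟨locallyIntegrableOn_congr hf hfg.1,
    locallyIntegrableOn_congr hg hfg.2.1, fun φ h1 h2 h3 => ?_⟩
  have := hfg.2.2 φ h1 h2 h3
  rw [h.intervalIntegral_eq, h.intervalIntegral_eq] at this ⊢
  rw [integral_congr_ae (g := fun x => f x * deriv φ x), this,
    integral_congr_ae (g := fun x => g' x * φ x * deriv ψ x)]
  · filter_upwards [hg] with x hx; rw [hx]
  · filter_upwards [hf] with x hx; rw [hx]

lemma test_deriv_eq_zero {φ : ℝ → ℝ} {x : ℝ} (hx : x ∉ tsupport φ) : deriv φ x = 0 := by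
  by_contra hne
  exact hx (support_deriv_subset hne)

lemma IsWeakDelta.integrableOn_left {f g φ : ℝ → ℝ} (hfg : IsWeakDelta ψ a b f g)
    (h1 : ContDiff ℝ 1 φ) (h2 : HasCompactSupport φ) (h3 : tsupport φ ⊆ Ioo a b) :
    IntegrableOn (fun x => f x * deriv φ x) (Ioo a b) :=
  integrableOn_mul_of_compact_support hfg.1 (h1.continuous_deriv_one).continuousOn h2.isCompact h3
    fun _ hx => test_deriv_eq_zero hx

lemma IsWeakDelta.integrableOn_right (h : IsScale ψ a b) {f g φ : ℝ → ℝ}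
    (hfg : IsWeakDelta ψ a b f g)
    (h1 : ContDiff ℝ 1 φ) (h2 : HasCompactSupport φ) (h3 : tsupport φ ⊆ Ioo a b) :
    IntegrableOn (fun x => g x * φ x * deriv ψ x) (Ioo a b) := by
  simp only [mul_assoc]
  refine integrableOn_mul_of_compact_support hfg.2.1
    (h1.continuous.continuousOn.mul h.continuousOn_deriv) h2.isCompact h3 fun x hx => ?_
  simp [image_eq_zero_of_notMem_tsupport hx]

lemma IsWeakDelta.sub (h : IsScale ψ a b) {f f' g g' : ℝ → ℝ}
    (hfg : IsWeakDelta ψ a b f g) (hfg' : IsWeakDelta ψ a b f' g') :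
    IsWeakDelta ψ a b (fun x => f x - f' x) (fun x => g x - g' x) := by
  refine ⟨locallyIntegrableOn_sub hfg.1 hfg'.1, locallyIntegrableOn_sub hfg.2.1 hfg'.2.1, fun φ h1 h2 h3 => ?_⟩
  have e1 := hfg.2.2 φ h1 h2 h3
  have e2 := hfg'.2.2 φ h1 h2 h3
  rw [h.intervalIntegral_eq, h.intervalIntegral_eq] at e1 e2 ⊢
  simp only [sub_mul]
  rw [integral_sub (hfg.integrableOn_left h1 h2 h3) (hfg'.integrableOn_left h1 h2 h3),
    integral_sub (hfg.integrableOn_right h h1 h2 h3) (hfg'.integrableOn_right h h1 h2 h3), e1, e2]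
  ring

/-- The fundamental lemma of the calculus of variations gives `(g - g') ψ' = 0` almost everywhere,
and `ψ' > 0` can be divided out. Uniqueness is what allows an estimate proved for one representative
to be transferred to every weak derivative. -/
lemma IsWeakDelta.ae_eq (h : IsScale ψ a b) {f f' g g' : ℝ → ℝ}
    (hff' : f =ᵐ[volume.restrict (Ioo a b)] f')
    (hfg : IsWeakDelta ψ a b f g) (hfg' : IsWeakDelta ψ a b f' g') :
    g =ᵐ[volume.restrict (Ioo a b)] g' := by
  have hd := (hfg.congr h hff' (ae_eq_refl g)).sub h hfg'
  have key := isOpen_Ioo.ae_eq_zero_of_integral_contDiff_smul_eq_zero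
    (hd.2.1.mul_continuousOn h.continuousOn_deriv isOpen_Ioo.isLocallyClosed) (fun φ h1 h2 h3 => ?_)
  · rw [Filter.EventuallyEq, ae_restrict_iff' measurableSet_Ioo]
    filter_upwards [key] with x hx hxI
    have := (mul_eq_zero.1 (hx hxI)).resolve_right (h.deriv_pos hxI).ne'
    linarith
  · have e := hd.2.2 φ (h1.of_le (by exact_mod_cast le_top)) h2 h3
    simp only [sub_self, zero_mul, intervalIntegral.integral_zero] at e
    rw [h.intervalIntegral_eq] at e
    rw [← setIntegral_eq_integral_of_forall_compl_eq_zero (s := Ioo a b)]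
    · rw [← neg_eq_zero, e]
      congr 1
      refine setIntegral_congr_fun measurableSet_Ioo fun x _ => ?_
      simp only [smul_eq_mul]; ring
    · intro x hx
      simp [image_eq_zero_of_notMem_tsupport (fun hc => hx (h3 hc))]

lemma IsWeakDeltaPow.ae_eq (h : IsScale ψ a b) {n : ℕ} {f f' g g' : ℝ → ℝ}
    (hff' : f =ᵐ[volume.restrict (Ioo a b)] f')
    (hfg : IsWeakDeltaPow ψ a b n f g) (hfg' : IsWeakDeltaPow ψ a b n f' g') :
    g =ᵐ[volume.restrict (Ioo a b)] g' := by
  induction n generalizing g g' with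
  | zero => exact (EventuallyEq.symm hfg).trans (hff'.trans hfg')
  | succ n ih =>
    obtain ⟨k, hk, hkg⟩ := hfg
    obtain ⟨k', hk', hkg'⟩ := hfg'
    exact IsWeakDelta.ae_eq h (ih hk hk') hkg hkg'

lemma isWeakDeltaPow_of_chain {z : ℕ → ℝ → ℝ} {f : ℝ → ℝ} {n : ℕ}
    (h0 : f =ᵐ[volume.restrict (Ioo a b)] z 0)
    (hz : ∀ i < n, IsWeakDelta ψ a b (z i) (z (i + 1))) : IsWeakDeltaPow ψ a b n f (z n) := by
  induction n with
  | zero => exact h0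
  | succ n ih => exact ⟨z n, ih fun i hi => hz i (by omega), hz n (by omega)⟩

lemma IsScale.continuousOn_eval (h : IsScale ψ a b) (P : ℝ[X]) :
    ContinuousOn (fun x => P.eval (ψ x)) (Icc a b) :=
  P.continuous.comp_continuousOn h.continuousOn

lemma IsScale.hasDerivAt_eval (h : IsScale ψ a b) (P : ℝ[X]) {x : ℝ} (hx : x ∈ Ioo a b) :
    HasDerivAt (fun x => P.eval (ψ x)) (P.derivative.eval (ψ x) * deriv ψ x) x :=
  (P.hasDerivAt (ψ x)).comp x (h.hasDerivAt hx)

lemma IsScale.locallyIntegrableOn_eval (h : IsScale ψ a b) (P : ℝ[X]) :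
    LocallyIntegrableOn (fun x => P.eval (ψ x)) (Ioo a b) :=
  ((h.continuousOn_eval P).mono Ioo_subset_Icc_self).locallyIntegrableOn measurableSet_Ioo

lemma IsScale.exists_bound_eval (h : IsScale ψ a b) (P : ℝ[X]) :
    ∃ M : ℝ, ∀ x ∈ Icc a b, |P.eval (ψ x)| ≤ M :=
  isCompact_Icc.exists_bound_of_continuousOn (h.continuousOn_eval P)

lemma IsScale.integrableOn_eval_mul_deriv (h : IsScale ψ a b) (P : ℝ[X]) :
    IntegrableOn (fun x => P.eval (ψ x) * deriv ψ x) (Ioo a b) := by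
  obtain ⟨M, hM⟩ := h.exists_bound_eval P
  refine h.integrableOn_deriv.bdd_mul (c := M)
    (((h.continuousOn_eval P).mono Ioo_subset_Icc_self).aestronglyMeasurable measurableSet_Ioo) ?_
  filter_upwards [ae_restrict_mem measurableSet_Ioo] with x hx
  exact hM x (Ioo_subset_Icc_self hx)

lemma IsScale.isWeakDelta_eval (h : IsScale ψ a b) (P : ℝ[X]) :
    IsWeakDelta ψ a b (fun x => P.eval (ψ x)) (fun x => P.derivative.eval (ψ x)) := by
  refine ⟨h.locallyIntegrableOn_eval P, h.locallyIntegrableOn_eval _, fun φ h1 h2 h3 => ?_⟩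
  have hφ : ∀ x ∉ Ioo a b, φ x = 0 := fun x hx =>
    image_eq_zero_of_notMem_tsupport fun hc => hx (h3 hc)
  have e := intervalIntegral.integral_mul_deriv_eq_deriv_mul_of_hasDeriv_right (a := a) (b := b)
    (u := fun x => P.eval (ψ x)) (v := φ) (u' := fun x => P.derivative.eval (ψ x) * deriv ψ x)
    (v' := deriv φ) (by rw [uIcc_of_le h.lt.le]; exact h.continuousOn_eval P)
    h1.continuous.continuousOn
    (by
      rw [min_eq_left h.lt.le, max_eq_right h.lt.le]
      exact fun x hx => (h.hasDerivAt_eval P hx).hasDerivWithinAt)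
    (fun x _ => (h1.differentiable (by norm_num) x).hasDerivAt.hasDerivWithinAt)
    (by
      rw [intervalIntegrable_iff_integrableOn_Ioo_of_le h.lt.le]
      exact h.integrableOn_eval_mul_deriv _)
    (h1.continuous_deriv_one.intervalIntegrable _ _)
  rw [e, hφ a (by simp), hφ b (by simp)]
  simp only [mul_zero, sub_self, zero_sub]
  congr 1
  exact intervalIntegral.integral_congr fun x _ => mul_right_comm _ _ _

end WeakDelta

/-! ### Polynomials in `ψ` as elements of the weighted spaces. -/

/-- The polynomial `(ψ(b) - X) (X - ψ(a))`. -/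
def edgePoly (ψ : ℝ → ℝ) (a b : ℝ) : ℝ[X] := (C (ψ b) - X) * (X - C (ψ a))

namespace IsScale

variable {ψ : ℝ → ℝ} {a b : ℝ}

lemma eval_edgePoly_pos (h : IsScale ψ a b) {x : ℝ} (hx : x ∈ Ioo a b) :
    0 < (edgePoly ψ a b).eval (ψ x) := by
  have h1 := h.left_lt hx
  have h2 := h.lt_right hx
  simp only [edgePoly, eval_mul, eval_sub, eval_C, eval_X]
  exact mul_pos (by linarith) (by linarith)

lemma weight_natCast (k : ℕ) (x : ℝ) :
    weight ψ a b k k x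
      = kappa ψ a b ^ (2 * k + 1) * ((edgePoly ψ a b ^ k).eval (ψ x) * deriv ψ x) := by
  have : ((k : ℝ) + k + 1) = ((2 * k + 1 : ℕ) : ℝ) := by push_cast; ring
  simp only [weight, this, Real.rpow_natCast, edgePoly, eval_pow, eval_mul, eval_sub, eval_C,
    eval_X, mul_pow]
  ring

lemma isFiniteMeasure_weightMeasure_natCast (h : IsScale ψ a b) (k : ℕ) :
    IsFiniteMeasure (weightMeasure ψ a b k k) :=
  h.isFiniteMeasure_weightMeasure (by have := k.cast_nonneg (α := ℝ); linarith)
    (by have := k.cast_nonneg (α := ℝ); linarith)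

lemma memLp_eval (h : IsScale ψ a b) {α β : ℝ} (hα : -1 < α) (hβ : -1 < β) (P : ℝ[X]) :
    MemLp (fun x => P.eval (ψ x)) 2 (weightMeasure ψ a b α β) := by
  have := h.isFiniteMeasure_weightMeasure hα hβ
  obtain ⟨M, hM⟩ := h.exists_bound_eval P
  refine MemLp.of_bound ((h.aestronglyMeasurable_weightMeasure_iff _ _).2
    (((h.continuousOn_eval P).mono Ioo_subset_Icc_self).aestronglyMeasurable measurableSet_Ioo)) M ?_
  rw [h.ae_weightMeasure_iff]
  filter_upwards [ae_restrict_mem measurableSet_Ioo] with x hx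
  exact hM x (Ioo_subset_Icc_self hx)

lemma memLp_eval_natCast (h : IsScale ψ a b) (k : ℕ) (P : ℝ[X]) :
    MemLp (fun x => P.eval (ψ x)) 2 (weightMeasure ψ a b k k) :=
  h.memLp_eval (by have := k.cast_nonneg (α := ℝ); linarith)
    (by have := k.cast_nonneg (α := ℝ); linarith) P

lemma integral_natCast (h : IsScale ψ a b) (k : ℕ) (f : ℝ → ℝ) (P : ℝ[X]) :
    ∫ x, f x * P.eval (ψ x) ∂weightMeasure ψ a b k k = kappa ψ a b ^ (2 * k + 1) *
      ∫ x in Ioo a b, f x * ((edgePoly ψ a b ^ k * P).eval (ψ x) * deriv ψ x) := by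
  rw [h.integral_weightMeasure, ← integral_const_mul]
  refine setIntegral_congr_fun measurableSet_Ioo fun x _ => ?_
  simp only [weight_natCast, eval_mul]; ring

/-- Cauchy–Schwarz: with `Q = W^k S`, the factor `W^k(ψ) ψ'` is the weight up to a constant, and
`S(ψ)` is square integrable for it. -/
lemma integrableOn_mul_eval (h : IsScale ψ a b) {k : ℕ} {f : ℝ → ℝ}
    (hf : MemLp f 2 (weightMeasure ψ a b k k)) {Q : ℝ[X]} (hQ : edgePoly ψ a b ^ k ∣ Q) :
    IntegrableOn (fun x => f x * (Q.eval (ψ x) * deriv ψ x)) (Ioo a b) := by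
  obtain ⟨S, rfl⟩ := hQ
  have h1 := (h.integrableOn_mul_of_memLp hf (h.memLp_eval_natCast k S)).const_mul
    ((kappa ψ a b ^ (2 * k + 1))⁻¹)
  refine IntegrableOn.congr_fun h1 (fun x _ => ?_) measurableSet_Ioo
  have := pow_ne_zero (2 * k + 1) h.kappa_pos.ne'
  simp only [weight_natCast, eval_mul]
  field_simp

end IsScale

/-! ### Cutoffs, and integration by parts up to the end points. -/

/-- A smooth function that vanishes on `(-∞, 1]` and equals `1` on `[2, ∞)`. -/
def stepUp (y : ℝ) : ℝ := Real.smoothTransition (y - 1)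

lemma contDiff_stepUp : ContDiff ℝ 1 stepUp :=
  Real.smoothTransition.contDiff.comp (contDiff_id.sub contDiff_const)

lemma stepUp_eq_zero {y : ℝ} (hy : y ≤ 1) : stepUp y = 0 :=
  Real.smoothTransition.zero_of_nonpos (by linarith)

lemma stepUp_eq_one {y : ℝ} (hy : 2 ≤ y) : stepUp y = 1 :=
  Real.smoothTransition.one_of_one_le (by linarith)

lemma abs_stepUp_le (y : ℝ) : |stepUp y| ≤ 1 := by
  rw [stepUp, abs_of_nonneg (Real.smoothTransition.nonneg _)]
  exact Real.smoothTransition.le_one _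

lemma deriv_stepUp_eq_zero {y : ℝ} (hy : 2 < y) : deriv stepUp y = 0 := by
  have : stepUp =ᶠ[𝓝 y] fun _ => 1 := by
    filter_upwards [lt_mem_nhds hy] with z hz using stepUp_eq_one hz.le
  rw [this.deriv_eq]; simp

lemma exists_bound_mul_deriv_stepUp : ∃ M : ℝ, ∀ y : ℝ, 0 ≤ y → |y * deriv stepUp y| ≤ M := by
  obtain ⟨M, hM⟩ := (isCompact_Icc (a := (0 : ℝ)) (b := 2)).exists_bound_of_continuousOn
    (continuous_id.mul contDiff_stepUp.continuous_deriv_one).continuousOn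
  refine ⟨M, fun y hy => ?_⟩
  rcases le_or_gt y 2 with h2 | h2
  · exact hM y ⟨hy, h2⟩
  · rw [deriv_stepUp_eq_zero h2]
    have := (norm_nonneg _).trans (hM 0 ⟨le_rfl, by norm_num⟩)
    simpa using this

/-- The function `(W R) ∘ ψ` cut off near the end points, `W` being `edgePoly`. -/
def cutoff (ψ : ℝ → ℝ) (a b : ℝ) (R : ℝ[X]) (n : ℕ) (x : ℝ) : ℝ :=
  (Icc a b).indicator (fun x => (edgePoly ψ a b * R).eval (ψ x)
    * stepUp (n * (edgePoly ψ a b).eval (ψ x))) x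

namespace IsScale

variable {ψ : ℝ → ℝ} {a b : ℝ}

lemma isCompact_cutoff_set (h : IsScale ψ a b) (n : ℕ) :
    IsCompact (Icc a b ∩ (fun x => (n : ℝ) * (edgePoly ψ a b).eval (ψ x)) ⁻¹' Ici 1) := by
  apply isCompact_Icc.of_isClosed_subset _ inter_subset_left
  exact (continuousOn_const.mul (h.continuousOn_eval _)).preimage_isClosed_of_isClosed isClosed_Icc
    isClosed_Ici

lemma cutoff_set_subset (n : ℕ) :
    Icc a b ∩ (fun x => (n : ℝ) * (edgePoly ψ a b).eval (ψ x)) ⁻¹' Ici 1 ⊆ Ioo a b := by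
  rintro x ⟨hx, hx1⟩
  have hx1 : 1 ≤ (n : ℝ) * (edgePoly ψ a b).eval (ψ x) := hx1
  refine ⟨lt_of_le_of_ne hx.1 ?_, lt_of_le_of_ne hx.2 ?_⟩
  · rintro rfl
    simp [edgePoly] at hx1
    linarith
  · rintro rfl
    simp [edgePoly] at hx1
    linarith

lemma cutoff_eq_zero {R : ℝ[X]} {n : ℕ} {x : ℝ}
    (hx : x ∉ Icc a b ∩ (fun x => (n : ℝ) * (edgePoly ψ a b).eval (ψ x)) ⁻¹' Ici 1) :
    cutoff ψ a b R n x = 0 := by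
  by_cases hxI : x ∈ Icc a b
  · have : ¬ (1 ≤ (n : ℝ) * (edgePoly ψ a b).eval (ψ x)) := fun hc => hx ⟨hxI, hc⟩
    simp [cutoff, hxI, stepUp_eq_zero (not_le.1 this).le]
  · simp [cutoff, hxI]

lemma tsupport_cutoff (h : IsScale ψ a b) (R : ℝ[X]) (n : ℕ) : tsupport (cutoff ψ a b R n) ⊆
    Icc a b ∩ (fun x => (n : ℝ) * (edgePoly ψ a b).eval (ψ x)) ⁻¹' Ici 1 := by
  apply closure_minimal _ (h.isCompact_cutoff_set n).isClosed
  intro x hx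
  by_contra hc
  exact hx (cutoff_eq_zero hc)

lemma hasCompactSupport_cutoff (h : IsScale ψ a b) (R : ℝ[X]) (n : ℕ) :
    HasCompactSupport (cutoff ψ a b R n) :=
  (h.isCompact_cutoff_set n).of_isClosed_subset (isClosed_tsupport _) (h.tsupport_cutoff R n)

lemma cutoff_eventuallyEq {R : ℝ[X]} {n : ℕ} {x : ℝ} (hx : x ∈ Ioo a b) :
    cutoff ψ a b R n =ᶠ[𝓝 x] fun x => (edgePoly ψ a b * R).eval (ψ x)
      * stepUp (n * (edgePoly ψ a b).eval (ψ x)) := by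
  filter_upwards [Icc_mem_nhds hx.1 hx.2] with y hy
  simp [cutoff, hy]

lemma contDiff_cutoff (h : IsScale ψ a b) (R : ℝ[X]) (n : ℕ) :
    ContDiff ℝ 1 (cutoff ψ a b R n) := by
  rw [contDiff_iff_contDiffAt]
  intro x
  by_cases hx : x ∈ Ioo a b
  · refine ContDiffAt.congr_of_eventuallyEq ?_ (cutoff_eventuallyEq hx)
    have hP : ∀ P : ℝ[X], ContDiffAt ℝ 1 (fun x => P.eval (ψ x)) x := fun P =>
      (show ContDiff ℝ 1 fun t => P.eval t by
        simpa [Polynomial.aeval_def] using P.contDiff_aeval (𝕜 := ℝ) 1).contDiffAt.comp x (h.contDiffAt hx)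
    exact (hP _).mul (contDiff_stepUp.contDiffAt.comp x (contDiffAt_const.mul (hP _)))
  · have hx' := fun hc => hx (cutoff_set_subset (ψ := ψ) n hc)
    have : cutoff ψ a b R n =ᶠ[𝓝 x] fun _ => 0 := by
      filter_upwards [(h.isCompact_cutoff_set n).isClosed.isOpen_compl.mem_nhds hx'] with y hy
      exact cutoff_eq_zero hy
    exact contDiffAt_const.congr_of_eventuallyEq this

/-- The factor `n` produced by the chain rule is grouped with the factor `W` of the test function.
This yields `y χ'(y)` at `y = n W(ψ)`, with `χ` the step function, which is bounded uniformly in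
`n`. -/
lemma deriv_cutoff (h : IsScale ψ a b) (R : ℝ[X]) (n : ℕ) {x : ℝ} (hx : x ∈ Ioo a b) :
    deriv (cutoff ψ a b R n) x =
      ((edgePoly ψ a b * R).derivative.eval (ψ x) * stepUp (n * (edgePoly ψ a b).eval (ψ x))
        + (R * (edgePoly ψ a b).derivative).eval (ψ x) * (n * (edgePoly ψ a b).eval (ψ x)
          * deriv stepUp (n * (edgePoly ψ a b).eval (ψ x)))) * deriv ψ x := by
  rw [(cutoff_eventuallyEq hx).deriv_eq]
  have h1 := h.hasDerivAt_eval (edgePoly ψ a b * R) hx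
  have h2 := (h.hasDerivAt_eval (edgePoly ψ a b) hx).const_mul (n : ℝ)
  have h3 := (contDiff_stepUp.differentiable (by norm_num)
    (n * (edgePoly ψ a b).eval (ψ x))).hasDerivAt.comp x h2
  have h4 := (h1.mul h3).deriv
  refine Eq.trans h4 ?_
  simp only [Function.comp, eval_mul]
  ring

/-- `(W R)(ψ)` is not compactly supported in `(a, b)`, so the weak identity is applied to its
cutoffs and passed to the limit by dominated convergence. One factor `W` suffices to absorb the
derivative of the cutoff; `hf'` dominates exactly that term. -/
lemma integral_weakDelta_mul_eval (h : IsScale ψ a b) {f g : ℝ → ℝ}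
    (hfg : IsWeakDelta ψ a b f g) (R : ℝ[X])
    (hg : IntegrableOn (fun x => g x * ((edgePoly ψ a b * R).eval (ψ x) * deriv ψ x)) (Ioo a b))
    (hf : IntegrableOn (fun x => f x * ((edgePoly ψ a b * R).derivative.eval (ψ x) * deriv ψ x))
      (Ioo a b))
    (hf' : IntegrableOn (fun x => f x * ((R * (edgePoly ψ a b).derivative).eval (ψ x) * deriv ψ x))
      (Ioo a b)) :
    ∫ x in Ioo a b, g x * ((edgePoly ψ a b * R).eval (ψ x) * deriv ψ x)
      = - ∫ x in Ioo a b, f x * ((edgePoly ψ a b * R).derivative.eval (ψ x) * deriv ψ x) := by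
  set W := edgePoly ψ a b with hW
  obtain ⟨M, hM⟩ := exists_bound_mul_deriv_stepUp
  have hid : ∀ n : ℕ, ∫ x in Ioo a b, f x * deriv (cutoff ψ a b R n) x
      = - ∫ x in Ioo a b, g x * cutoff ψ a b R n x * deriv ψ x := by
    intro n
    have := hfg.2.2 _ (h.contDiff_cutoff R n) (h.hasCompactSupport_cutoff R n)
      ((h.tsupport_cutoff R n).trans (cutoff_set_subset n))
    rwa [h.intervalIntegral_eq, h.intervalIntegral_eq] at this
  -- At a fixed interior point the cutoff is eventually locally constant equal to `1`, so both
  -- integrands are eventually equal to their limits.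
  have hlarge : ∀ x ∈ Ioo a b, ∀ᶠ n : ℕ in atTop, 2 < (n : ℝ) * W.eval (ψ x) := fun x hx =>
    (tendsto_natCast_atTop_atTop.atTop_mul_const (h.eval_edgePoly_pos hx)).eventually_gt_atTop 2
  have hL : Tendsto (fun n : ℕ => ∫ x in Ioo a b, f x * deriv (cutoff ψ a b R n) x) atTop
      (𝓝 (∫ x in Ioo a b, f x * ((W * R).derivative.eval (ψ x) * deriv ψ x))) := by
    refine tendsto_integral_of_dominated_convergence
      (fun x => |f x * ((W * R).derivative.eval (ψ x) * deriv ψ x)|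
        + M * |f x * ((R * W.derivative).eval (ψ x) * deriv ψ x)|)
      (fun n => (hfg.integrableOn_left (h.contDiff_cutoff R n) (h.hasCompactSupport_cutoff R n)
      ((h.tsupport_cutoff R n).trans (cutoff_set_subset n))).aestronglyMeasurable)
      (hf.abs.add (hf'.abs.const_mul M)) (fun n => ?_) ?_
    · filter_upwards [ae_restrict_mem measurableSet_Ioo] with x hx
      rw [h.deriv_cutoff R n hx, Real.norm_eq_abs, add_mul, mul_add]
      refine (abs_add_le _ _).trans (add_le_add ?_ ?_)
      · rw [show f x * ((derivative (W * R)).eval (ψ x) * stepUp (n * W.eval (ψ x)) * deriv ψ x)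
          = stepUp (n * W.eval (ψ x)) * (f x * ((derivative (W * R)).eval (ψ x) * deriv ψ x))
          by ring, abs_mul]
        exact mul_le_of_le_one_left (abs_nonneg _) (abs_stepUp_le _)
      · rw [show f x * ((R * derivative W).eval (ψ x) * (n * W.eval (ψ x)
            * deriv stepUp (n * W.eval (ψ x))) * deriv ψ x)
          = (n * W.eval (ψ x) * deriv stepUp (n * W.eval (ψ x)))
            * (f x * ((R * derivative W).eval (ψ x) * deriv ψ x)) by ring, abs_mul]
        exact mul_le_mul_of_nonneg_right
          (hM _ (mul_nonneg n.cast_nonneg (h.eval_edgePoly_pos hx).le)) (abs_nonneg _)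
    · filter_upwards [ae_restrict_mem measurableSet_Ioo] with x hx
      refine tendsto_const_nhds.congr' ?_
      filter_upwards [hlarge x hx] with n hn
      rw [h.deriv_cutoff R n hx, stepUp_eq_one hn.le, deriv_stepUp_eq_zero hn]
      ring
  have hR : Tendsto (fun n : ℕ => ∫ x in Ioo a b, g x * cutoff ψ a b R n x * deriv ψ x) atTop
      (𝓝 (∫ x in Ioo a b, g x * ((W * R).eval (ψ x) * deriv ψ x))) := by
    refine tendsto_integral_of_dominated_convergence
      (fun x => |g x * ((W * R).eval (ψ x) * deriv ψ x)|)
      (fun n => (hfg.integrableOn_right h (h.contDiff_cutoff R n) (h.hasCompactSupport_cutoff R n)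
      ((h.tsupport_cutoff R n).trans (cutoff_set_subset n))).aestronglyMeasurable)
      hg.abs (fun n => ?_) ?_
    · filter_upwards [ae_restrict_mem measurableSet_Ioo] with x hx
      rw [(cutoff_eventuallyEq hx).eq_of_nhds, Real.norm_eq_abs]
      rw [show g x * ((W * R).eval (ψ x) * stepUp (n * W.eval (ψ x))) * deriv ψ x
        = stepUp (n * W.eval (ψ x)) * (g x * ((W * R).eval (ψ x) * deriv ψ x)) by ring, abs_mul]
      exact mul_le_of_le_one_left (abs_nonneg _) (abs_stepUp_le _)
    · filter_upwards [ae_restrict_mem measurableSet_Ioo] with x hx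
      refine tendsto_const_nhds.congr' ?_
      filter_upwards [hlarge x hx] with n hn
      rw [(cutoff_eventuallyEq hx).eq_of_nhds, stepUp_eq_one hn.le]
      ring
  have := tendsto_nhds_unique hL (by simpa only [hid] using hR.neg)
  rw [this, neg_neg]

/-- Each integration by parts lowers the order of the derivative of `z` by one and costs one factor
`W` of `P`. The weight at the lower order has one factor `W` less as well, so divisibility by `W^k`
keeps every integrand integrable. -/
lemma integral_chain_mul_eval (h : IsScale ψ a b) {z : ℕ → ℝ → ℝ} {k : ℕ}
    (hz : ∀ i < k, IsWeakDelta ψ a b (z i) (z (i + 1)))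
    (hL : ∀ i ≤ k, MemLp (z i) 2 (weightMeasure ψ a b i i)) {P : ℝ[X]}
    (hP : edgePoly ψ a b ^ k ∣ P) :
    ∫ x in Ioo a b, z k x * (P.eval (ψ x) * deriv ψ x)
      = (-1) ^ k * ∫ x in Ioo a b, z 0 x * ((derivative^[k] P).eval (ψ x) * deriv ψ x) := by
  induction k generalizing P with
  | zero => simp
  | succ k ih =>
    have hP' : edgePoly ψ a b ^ k ∣ derivative P := by
      simpa using pow_sub_one_dvd_derivative_of_pow_dvd hP
    have hg := h.integrableOn_mul_eval (hL (k + 1) le_rfl) hP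
    have hf := h.integrableOn_mul_eval (hL k (by omega)) hP'
    have e := ih (fun i hi => hz i (by omega)) (fun i hi => hL i (by omega)) hP'
    obtain ⟨S, rfl⟩ := hP
    rw [pow_succ', mul_assoc] at *
    rw [h.integral_weakDelta_mul_eval (hz k (by omega)) _ hg hf
      (h.integrableOn_mul_eval (hL k (by omega)) (by
        rw [mul_assoc]; exact dvd_mul_right _ _)), e, Function.iterate_succ_apply]
    ring

end IsScale

end PsiSpectral

end

noncomputable section

namespace PsiSpectral

open Polynomial Filter Topology

/-! ### Legendre polynomials on `[ψ(a), ψ(b)]` -/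

/-- The (unnormalised) Legendre polynomial of degree `n` on `[ψ(a), ψ(b)]`. -/
def legendrePoly (ψ : ℝ → ℝ) (a b : ℝ) (n : ℕ) : ℝ[X] := derivative^[n] (edgePoly ψ a b ^ n)

/-- The operator `P ↦ (-1)^k D^k (W^k D^k P)`, `W` being `edgePoly`. -/
def legendreOp (ψ : ℝ → ℝ) (a b : ℝ) (k : ℕ) (P : ℝ[X]) : ℝ[X] :=
  C ((-1) ^ k) * derivative^[k] (edgePoly ψ a b ^ k * derivative^[k] P)

/-- The eigenvalue of `legendreOp` of order `k` at the Legendre polynomial of degree `n`. -/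
def legendreEig (k n : ℕ) : ℕ := (n + k).descFactorial k * n.descFactorial k

/-- The inner product `∫ P(ψ) Q(ψ) dψ` on polynomials. -/
def polyInner (ψ : ℝ → ℝ) (a b : ℝ) (P Q : ℝ[X]) : ℝ :=
  ∫ x in Ioo a b, P.eval (ψ x) * (Q.eval (ψ x) * deriv ψ x)

section Algebra

variable {ψ : ℝ → ℝ} {a b : ℝ}

lemma natDegree_edgePoly_le : (edgePoly ψ a b).natDegree ≤ 2 := by
  unfold edgePoly; compute_degree

lemma coeff_edgePoly_two : (edgePoly ψ a b).coeff 2 = -1 := by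
  have : edgePoly ψ a b = -X ^ 2 + C (ψ b + ψ a) * X - C (ψ b * ψ a) := by
    simp only [edgePoly, C_add, C_mul]; ring
  rw [this]
  simp

lemma natDegree_edgePoly_pow_le (k : ℕ) : (edgePoly ψ a b ^ k).natDegree ≤ k * 2 :=
  natDegree_pow_le_of_le k natDegree_edgePoly_le

lemma coeff_edgePoly_pow (k : ℕ) : (edgePoly ψ a b ^ k).coeff (k * 2) = (-1) ^ k := by
  rw [coeff_pow_of_natDegree_le natDegree_edgePoly_le, coeff_edgePoly_two]

lemma natDegree_legendrePoly_le (n : ℕ) : (legendrePoly ψ a b n).natDegree ≤ n := by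
  refine (natDegree_iterate_derivative _ _).trans ?_
  have := natDegree_edgePoly_pow_le (ψ := ψ) (a := a) (b := b) n
  omega

lemma coeff_legendrePoly_ne_zero (n : ℕ) : (legendrePoly ψ a b n).coeff n ≠ 0 := by
  rw [legendrePoly, coeff_iterate_derivative, ← mul_two, coeff_edgePoly_pow]
  simp only [nsmul_eq_mul, ne_eq, mul_eq_zero, Nat.cast_eq_zero, Nat.descFactorial_eq_zero_iff_lt,
    pow_eq_zero_iff', neg_eq_zero, one_ne_zero, false_and, or_false]
  omega

/-- `D^l L_{n+l}` has degree exactly `n`, so these polynomials already form a basis; the indices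
below `l` contribute only zero. -/
lemma span_iterate_derivative_legendrePoly (l : ℕ) :
    Submodule.span ℝ (Set.range fun n => derivative^[l] (legendrePoly ψ a b n)) = ⊤ := by
  let S : Polynomial.Sequence ℝ :=
    { elems' := fun n => derivative^[l] (legendrePoly ψ a b (n + l))
      degree_eq' := fun n => by
        apply degree_eq_of_le_of_coeff_ne_zero
        · apply degree_le_of_natDegree_le
          refine (natDegree_iterate_derivative _ _).trans ?_
          have := natDegree_legendrePoly_le (ψ := ψ) (a := a) (b := b) (n + l)
          omega
        · rw [coeff_iterate_derivative]
          simp only [nsmul_eq_mul, ne_eq, mul_eq_zero, not_or]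
          refine ⟨?_, coeff_legendrePoly_ne_zero _⟩
          simp [Nat.descFactorial_eq_zero_iff_lt] }
  have hS := S.span fun i => (leadingCoeff_ne_zero.2 (S.ne_zero i)).isUnit
  rw [eq_top_iff, ← hS]
  apply Submodule.span_mono
  rintro _ ⟨n, rfl⟩
  exact ⟨n + l, rfl⟩

lemma coeff_legendreOp_of_degree_lt {k n j : ℕ} {P : ℝ[X]} (hP : P.degree < n) (hj : n ≤ j) :
    (legendreOp ψ a b k P).coeff j = 0 := by
  rw [legendreOp, coeff_C_mul, coeff_iterate_derivative]
  by_cases hk : P.degree < k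
  · rw [iterate_derivative_eq_zero_of_degree_lt hk]; simp
  · have hP0 : P ≠ 0 := by rintro rfl; simp at hk
    rw [degree_eq_natDegree hP0] at hP hk
    have h1 : P.natDegree < n := by exact_mod_cast hP
    have h2 : k ≤ P.natDegree := by exact_mod_cast not_lt.1 hk
    rw [coeff_eq_zero_of_natDegree_lt]
    · simp
    · have h3 := natDegree_edgePoly_pow_le (ψ := ψ) (a := a) (b := b) k
      have h4 := natDegree_iterate_derivative P k
      have h5 := natDegree_mul_le (p := edgePoly ψ a b ^ k) (q := derivative^[k] P)
      omega

lemma degree_legendreOp_lt {k n : ℕ} {P : ℝ[X]} (hP : P.degree < n) :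
    (legendreOp ψ a b k P).degree < n :=
  (degree_lt_iff_coeff_zero _ _).2 fun _ hj => coeff_legendreOp_of_degree_lt hP hj

/-- The leading coefficient of `W^k` is `(-1)^k`, cancelling the sign in the operator. The two
descending factorials come from the inner and the outer `D^k`. -/
lemma coeff_legendreOp {k n : ℕ} {P : ℝ[X]} (hP : P.natDegree ≤ n) :
    (legendreOp ψ a b k P).coeff n = legendreEig k n * P.coeff n := by
  rw [legendreOp, coeff_C_mul, coeff_iterate_derivative, legendreEig]
  rcases lt_or_ge n k with hk | hk
  · rw [iterate_derivative_eq_zero (by omega), Nat.descFactorial_eq_zero_iff_lt.2 hk]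
    simp
  · obtain ⟨j, rfl⟩ := Nat.exists_eq_add_of_le' hk
    rw [show j + k + k = k * 2 + j by ring, coeff_mul_add_eq_of_natDegree_le
      (natDegree_edgePoly_pow_le k) ((natDegree_iterate_derivative _ _).trans (by omega)),
      coeff_edgePoly_pow, coeff_iterate_derivative]
    have : ((-1 : ℝ) ^ k) * (-1) ^ k = 1 := by rw [← mul_pow]; simp
    simp only [nsmul_eq_mul, Nat.cast_mul]
    linear_combination ((k * 2 + j).descFactorial k * (j + k).descFactorial k
      * P.coeff (j + k) : ℝ) * this

end Algebra

namespace IsScale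

variable {ψ : ℝ → ℝ} {a b : ℝ}

lemma integrableOn_polyInner (h : IsScale ψ a b) (P Q : ℝ[X]) :
    IntegrableOn (fun x => P.eval (ψ x) * (Q.eval (ψ x) * deriv ψ x)) (Ioo a b) := by
  refine IntegrableOn.congr_fun (h.integrableOn_eval_mul_deriv (P * Q)) (fun x _ => ?_)
    measurableSet_Ioo
  simp only [eval_mul]; ring

lemma polyInner_comm (P Q : ℝ[X]) : polyInner ψ a b P Q = polyInner ψ a b Q P :=
  setIntegral_congr_fun measurableSet_Ioo fun x _ => by ring

lemma polyInner_sub_left (h : IsScale ψ a b) (P Q R : ℝ[X]) :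
    polyInner ψ a b (P - Q) R = polyInner ψ a b P R - polyInner ψ a b Q R := by
  simp only [polyInner, eval_sub, sub_mul]
  exact integral_sub (h.integrableOn_polyInner P R) (h.integrableOn_polyInner Q R)

lemma polyInner_C_mul_left (c : ℝ) (P R : ℝ[X]) :
    polyInner ψ a b (C c * P) R = c * polyInner ψ a b P R := by
  simp only [polyInner, eval_mul, eval_C, mul_assoc]
  exact integral_const_mul _ _

/-- A nonzero polynomial has finitely many roots and `ψ` is injective, so `P(ψ)` would vanish only
on a finite set. -/
lemma eq_zero_of_ae_eval_eq_zero (h : IsScale ψ a b) {P : ℝ[X]}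
    (hP : ∀ᵐ x ∂volume.restrict (Ioo a b), P.eval (ψ x) = 0) : P = 0 := by
  by_contra hne
  have hfin : (Ioo a b ∩ ψ ⁻¹' {t | P.IsRoot t}).Finite := by
    refine ((finite_setOfPred_isRoot hne).preimage (f := (Ioo a b).domRestrict ψ)
      (injOn_iff_injective.1 (h.strictMonoOn.injOn.mono Ioo_subset_Icc_self)).injOn).image
      Subtype.val |>.subset ?_
    rintro x ⟨hx, hx'⟩
    exact ⟨⟨x, hx⟩, hx', rfl⟩
  have h0 : volume (Ioo a b) = 0 := by
    refine measure_mono_null (t := (Ioo a b ∩ ψ ⁻¹' {t | P.IsRoot t}) ∪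
      {x | ¬ (x ∈ Ioo a b → P.eval (ψ x) = 0)}) (fun x hx => ?_)
      (measure_union_null (hfin.measure_zero _) ?_)
    · by_cases hx' : P.eval (ψ x) = 0
      · exact Or.inl ⟨hx, hx'⟩
      · exact Or.inr fun hc => hx' (hc hx)
    · exact (ae_restrict_iff' measurableSet_Ioo).1 hP
  rw [Real.volume_Ioo, ENNReal.ofReal_eq_zero] at h0
  linarith [h.lt]

lemma eq_zero_of_polyInner_self (h : IsScale ψ a b) {P : ℝ[X]} (hP : polyInner ψ a b P P = 0) :
    P = 0 := by
  apply h.eq_zero_of_ae_eval_eq_zero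
  rw [polyInner, setIntegral_eq_zero_iff_of_nonneg_ae _ (h.integrableOn_polyInner P P)] at hP
  · filter_upwards [hP, ae_restrict_mem measurableSet_Ioo] with x hx hxI
    have := (h.deriv_pos hxI).ne'
    simpa [this] using hx
  · filter_upwards [ae_restrict_mem measurableSet_Ioo] with x hxI
    have := (h.deriv_pos hxI).le
    simp only [Pi.zero_apply, ← mul_assoc]
    exact mul_nonneg (mul_self_nonneg _) this

lemma isWeakDelta_iterate_derivative (h : IsScale ψ a b) (P : ℝ[X]) (i : ℕ) :
    IsWeakDelta ψ a b (fun x => (derivative^[i] P).eval (ψ x))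
      (fun x => (derivative^[i + 1] P).eval (ψ x)) := by
  rw [Function.iterate_succ_apply']
  exact h.isWeakDelta_eval _

lemma integral_chain_legendreOp (h : IsScale ψ a b) {z : ℕ → ℝ → ℝ} {k : ℕ}
    (hz : ∀ i < k, IsWeakDelta ψ a b (z i) (z (i + 1)))
    (hL : ∀ i ≤ k, MemLp (z i) 2 (weightMeasure ψ a b i i)) (P : ℝ[X]) :
    ∫ x in Ioo a b, z k x * ((edgePoly ψ a b ^ k * derivative^[k] P).eval (ψ x) * deriv ψ x)
      = ∫ x in Ioo a b, z 0 x * ((legendreOp ψ a b k P).eval (ψ x) * deriv ψ x) := by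
  rw [h.integral_chain_mul_eval hz hL (dvd_mul_right _ _), ← integral_const_mul]
  refine setIntegral_congr_fun measurableSet_Ioo fun x _ => ?_
  simp only [legendreOp, eval_mul, eval_C]
  ring

lemma polyInner_legendreOp (h : IsScale ψ a b) (k : ℕ) (P Q : ℝ[X]) :
    polyInner ψ a b P (legendreOp ψ a b k Q)
      = polyInner ψ a b (derivative^[k] P) (edgePoly ψ a b ^ k * derivative^[k] Q) :=
  (h.integral_chain_legendreOp (z := fun i x => (derivative^[i] P).eval (ψ x))
    (fun i _ => h.isWeakDelta_iterate_derivative P i) (fun i _ => h.memLp_eval_natCast i _) Q).symm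

lemma polyInner_legendreOp_comm (h : IsScale ψ a b) (k : ℕ) (P Q : ℝ[X]) :
    polyInner ψ a b P (legendreOp ψ a b k Q) = polyInner ψ a b (legendreOp ψ a b k P) Q := by
  rw [polyInner_comm (legendreOp ψ a b k P), h.polyInner_legendreOp, h.polyInner_legendreOp]
  refine setIntegral_congr_fun measurableSet_Ioo fun x _ => ?_
  simp only [eval_mul]; ring

/-- Rodrigues' formula: `n` integrations by parts move `D^n` from `W^n` onto `P`, which it kills. -/
lemma polyInner_legendrePoly_of_degree_lt (h : IsScale ψ a b) {n : ℕ} {P : ℝ[X]}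
    (hP : P.degree < n) : polyInner ψ a b P (legendrePoly ψ a b n) = 0 := by
  have e := h.integral_chain_mul_eval (z := fun i x => (derivative^[i] P).eval (ψ x)) (k := n)
    (P := edgePoly ψ a b ^ n)
    (fun i _ => h.isWeakDelta_iterate_derivative P i) (fun i _ => h.memLp_eval_natCast i _)
    dvd_rfl
  rw [iterate_derivative_eq_zero_of_degree_lt hP] at e
  simp only [eval_zero, zero_mul, integral_zero, Function.iterate_zero, id] at e
  exact ((mul_eq_zero.1 e.symm).resolve_left (by simp))

/-- The difference `E` of the two sides has degree below `n`, because the top coefficients agree. By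
symmetry of the operator, `⟨E, E⟩` reduces to pairings of `L_n` with polynomials of degree below
`n`, hence vanishes. -/
lemma legendreOp_legendrePoly (h : IsScale ψ a b) (k n : ℕ) :
    legendreOp ψ a b k (legendrePoly ψ a b n)
      = C (legendreEig k n : ℝ) * legendrePoly ψ a b n := by
  set L := legendrePoly ψ a b n
  set E := legendreOp ψ a b k L - C (legendreEig k n : ℝ) * L with hE
  have hL : L.natDegree ≤ n := natDegree_legendrePoly_le n
  have hdeg : E.degree < n := by
    rw [degree_lt_iff_coeff_zero]
    intro j hj
    rcases hj.eq_or_lt with rfl | hj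
    · rw [hE, coeff_sub, coeff_C_mul, coeff_legendreOp hL, sub_self]
    · rw [hE, coeff_sub, coeff_C_mul, coeff_eq_zero_of_natDegree_lt (hL.trans_lt hj),
        coeff_legendreOp_of_degree_lt (n := n + 1) _ hj]
      · simp
      · exact (degree_le_of_natDegree_le hL).trans_lt (by exact_mod_cast n.lt_succ_self)
  have h0 : polyInner ψ a b E E = 0 := by
    nth_rewrite 1 [hE]
    rw [h.polyInner_sub_left, polyInner_C_mul_left, ← h.polyInner_legendreOp_comm,
      polyInner_comm, h.polyInner_legendrePoly_of_degree_lt (degree_legendreOp_lt hdeg),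
      polyInner_comm, h.polyInner_legendrePoly_of_degree_lt hdeg]
    simp
  exact sub_eq_zero.1 (h.eq_zero_of_polyInner_self h0)

lemma polyInner_legendrePoly_ne (h : IsScale ψ a b) {i j : ℕ} (hij : i ≠ j) :
    polyInner ψ a b (legendrePoly ψ a b i) (legendrePoly ψ a b j) = 0 := by
  have key : ∀ {i j : ℕ}, i < j →
      polyInner ψ a b (legendrePoly ψ a b i) (legendrePoly ψ a b j) = 0 := fun {i j} hlt =>
    h.polyInner_legendrePoly_of_degree_lt
      ((degree_le_of_natDegree_le (natDegree_legendrePoly_le i)).trans_lt (by exact_mod_cast hlt))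
  rcases lt_or_gt_of_ne hij with hlt | hlt
  · exact key hlt
  · rw [polyInner_comm]; exact key hlt

lemma polyInner_legendrePoly_self_ne_zero (h : IsScale ψ a b) (n : ℕ) :
    polyInner ψ a b (legendrePoly ψ a b n) (legendrePoly ψ a b n) ≠ 0 := fun hc =>
  coeff_legendrePoly_ne_zero (ψ := ψ) (a := a) (b := b) n
    (by rw [h.eq_zero_of_polyInner_self hc, coeff_zero])

end IsScale

/-! ### Comparison of norms through orthogonal expansions -/

section Hilbert

variable {E F : Type*} [NormedAddCommGroup E] [InnerProductSpace ℝ E]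
  [NormedAddCommGroup F] [InnerProductSpace ℝ F]

local notation "⟪" x ", " y "⟫" => inner ℝ x y

lemma inner_sum_smul_of_orthogonal {e : ℕ → E} (he : ∀ i j, i ≠ j → ⟪e i, e j⟫ = 0)
    (S : Finset ℕ) (c : ℕ → ℝ) : ‖∑ i ∈ S, c i • e i‖ ^ 2 = ∑ i ∈ S, c i ^ 2 * ‖e i‖ ^ 2 := by
  rw [← real_inner_self_eq_norm_sq, sum_inner]
  refine Finset.sum_congr rfl fun i hi => ?_
  rw [inner_sum, Finset.sum_eq_single_of_mem i hi fun j _ hj => by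
    rw [real_inner_smul_left, real_inner_smul_right, he i j hj.symm]; simp]
  rw [real_inner_smul_left, real_inner_smul_right, real_inner_self_eq_norm_sq]
  ring

/-- Bessel's inequality. Nothing is asked of `⟪f n, y⟫` when `c n = 0`; in the application these are
the indices where `y` still contains the part removed by the projection. -/
lemma sum_le_norm_sq_of_orthogonal {f : ℕ → F} (hf : ∀ i j, i ≠ j → ⟪f i, f j⟫ = 0)
    (S : Finset ℕ) (c : ℕ → ℝ) {y : F} (hc : ∀ n ∈ S, c n ≠ 0 → ⟪f n, y⟫ = c n * ‖f n‖ ^ 2) :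
    ∑ i ∈ S, c i ^ 2 * ‖f i‖ ^ 2 ≤ ‖y‖ ^ 2 := by
  have h1 := norm_sub_sq_real y (∑ i ∈ S, c i • f i)
  have h2 : ⟪y, ∑ i ∈ S, c i • f i⟫ = ∑ i ∈ S, c i ^ 2 * ‖f i‖ ^ 2 := by
    rw [inner_sum]
    refine Finset.sum_congr rfl fun i hi => ?_
    by_cases h0 : c i = 0
    · simp [h0]
    · rw [real_inner_smul_right, real_inner_comm, hc i hi h0]; ring
  rw [h2, inner_sum_smul_of_orthogonal hf] at h1
  nlinarith [sq_nonneg ‖y - ∑ i ∈ S, c i • f i‖]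

/-- Parseval's identity for `y` against Bessel's inequality for `v`. -/
lemma norm_sq_le_of_orthogonal_expansions {e : ℕ → E} {f : ℕ → F}
    (he : ∀ i j, i ≠ j → ⟪e i, e j⟫ = 0) (hf : ∀ i j, i ≠ j → ⟪f i, f j⟫ = 0) {y : E} {v : F}
    (hy : y ∈ closure (Submodule.span ℝ (Set.range e) : Set E)) (c : ℕ → ℝ)
    (hcy : ∀ n, ⟪e n, y⟫ = c n * ‖e n‖ ^ 2) (hcv : ∀ n, c n ≠ 0 → ⟪f n, v⟫ = c n * ‖f n‖ ^ 2)
    {K : ℝ} (hK : 0 ≤ K) (hef : ∀ n, c n ≠ 0 → ‖e n‖ ^ 2 ≤ K * ‖f n‖ ^ 2) :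
    ‖y‖ ≤ Real.sqrt K * ‖v‖ := by
  refine le_of_forall_pos_le_add fun ε hε => ?_
  obtain ⟨s, hs, hys⟩ := Metric.mem_closure_iff.1 hy ε hε
  obtain ⟨r, hr⟩ := (Finsupp.mem_span_range_iff_exists_finsupp).1 hs
  set S := r.support
  set t := ∑ i ∈ S, c i • e i with ht
  -- `t` is the orthogonal projection of `y` onto the span of the `e i` with `i ∈ S`, so it
  -- approximates `y` at least as well as `s` does.
  have horth : ⟪y - t, s - t⟫ = 0 := by
    have hst : s - t = ∑ i ∈ S, (r i - c i) • e i := by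
      simp only [sub_smul, Finset.sum_sub_distrib, ← hr, ht, Finsupp.sum, S]
    rw [hst, inner_sum]
    refine Finset.sum_eq_zero fun i hi => ?_
    rw [real_inner_smul_right, inner_sub_left, ht, sum_inner, Finset.sum_eq_single_of_mem i hi
      fun j _ hj => by rw [real_inner_smul_left, he j i hj]; simp,
      real_inner_smul_left, real_inner_self_eq_norm_sq, real_inner_comm, hcy]
    ring
  have h1 : ‖y - t‖ ≤ ‖y - s‖ := by
    have e1 : y - s = (y - t) - (s - t) := by abel
    have e2 := norm_sub_sq_real (y - t) (s - t)
    rw [← e1, horth] at e2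
    refine (sq_le_sq₀ (norm_nonneg _) (norm_nonneg _)).1 ?_
    nlinarith [sq_nonneg ‖s - t‖]
  have h2 : ‖t‖ ≤ Real.sqrt K * ‖v‖ := by
    refine (sq_le_sq₀ (norm_nonneg _) (by positivity)).1 ?_
    rw [inner_sum_smul_of_orthogonal he, mul_pow, Real.sq_sqrt hK]
    refine le_trans ?_ (mul_le_mul_of_nonneg_left
      (sum_le_norm_sq_of_orthogonal hf S c fun n _ => hcv n) hK)
    rw [Finset.mul_sum]
    refine Finset.sum_le_sum fun i _ => ?_
    by_cases h0 : c i = 0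
    · simp [h0]
    · nlinarith [hef i h0, sq_nonneg (c i)]
  rw [dist_eq_norm] at hys
  have := norm_add_le (y - t) t
  rw [sub_add_cancel] at this
  linarith

end Hilbert

/-! ### Density of the polynomials in `ψ` -/

namespace IsScale

variable {ψ : ℝ → ℝ} {a b : ℝ}

/-- Stone–Weierstrass: the algebra generated by `ψ` separates the points of `[a, b]` because `ψ` is
injective there. -/
lemma exists_eval_near (h : IsScale ψ a b) {g : ℝ → ℝ} (hg : Continuous g) {δ : ℝ} (hδ : 0 < δ) :
    ∃ P : ℝ[X], ∀ x ∈ Icc a b, |g x - P.eval (ψ x)| < δ := by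
  let ψ' : C(Icc a b, ℝ) := ⟨(Icc a b).domRestrict ψ, h.continuousOn.domRestrict⟩
  have htop := ContinuousMap.subalgebra_topologicalClosure_eq_top_of_separatesPoints
    (Algebra.adjoin ℝ {ψ'}) (fun x y hxy => ⟨ψ', ⟨ψ', Algebra.subset_adjoin rfl, rfl⟩,
      fun hc => hxy (Subtype.ext (h.strictMonoOn.injOn x.2 y.2 hc))⟩)
  have hmem : (⟨(Icc a b).domRestrict g, hg.continuousOn.domRestrict⟩ : C(Icc a b, ℝ)) ∈
      (Algebra.adjoin ℝ {ψ'}).topologicalClosure := htop ▸ Algebra.mem_top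
  obtain ⟨q, hq, hgq⟩ := Metric.mem_closure_iff.1 hmem δ hδ
  rw [SetLike.mem_coe, Algebra.adjoin_singleton_eq_range_aeval] at hq
  obtain ⟨P, rfl⟩ := hq
  refine ⟨P, fun x hx => ?_⟩
  have := (ContinuousMap.dist_apply_le_dist ⟨x, hx⟩).trans_lt hgq
  rw [Real.dist_eq] at this
  have e : (aeval ψ' P) ⟨x, hx⟩ = P.eval (ψ x) := by
    rw [aeval_def, eval₂_eq_sum_range, eval_eq_sum_range]
    simp [ψ', Set.domRestrict_apply]
  rw [← e]
  exact this

/-- The map `P ↦ P ∘ ψ` into `L²`. -/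
def polyLp (h : IsScale ψ a b) (k : ℕ) : ℝ[X] →ₗ[ℝ] Lp ℝ 2 (weightMeasure ψ a b k k) where
  toFun P := (h.memLp_eval_natCast k P).toLp
  map_add' P Q := by
    rw [← MemLp.toLp_add]
    congr 1
    ext x
    simp
  map_smul' c P := by
    rw [RingHom.id_apply, ← MemLp.toLp_const_smul]
    congr 1
    ext x
    simp

lemma exists_polyLp_near (h : IsScale ψ a b) (k : ℕ) (y : Lp ℝ 2 (weightMeasure ψ a b k k))
    {ε : ℝ} (hε : 0 < ε) : ∃ P : ℝ[X], dist y (h.polyLp k P) < ε := by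
  have := h.isFiniteMeasure_weightMeasure_natCast k
  obtain ⟨g, hg, hgL⟩ := (Lp.memLp y).exists_boundedContinuous_eLpNorm_sub_le
    (ε := ENNReal.ofReal (ε / 3)) (by norm_num)
    (by simpa using hε)
  -- `M` is the square root of the total mass, the factor between the uniform and the `L²` norm.
  -- Dividing by `M + 1` below avoids a separate case `M = 0`.
  set M : ℝ := (weightMeasure ψ a b k k univ ^ (2 : ENNReal).toReal⁻¹).toReal with hM
  have hM0 : 0 ≤ M := ENNReal.toReal_nonneg
  obtain ⟨P, hP⟩ := h.exists_eval_near g.continuous (δ := ε / (3 * (M + 1))) (by positivity)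
  refine ⟨P, ?_⟩
  have hPL := h.memLp_eval_natCast k P
  have h1 : dist y hgL.toLp ≤ ε / 3 := by
    rw [Lp.dist_def]
    refine ENNReal.toReal_le_of_le_ofReal (by positivity) ?_
    rwa [eLpNorm_congr_ae ((ae_eq_refl (y : ℝ → ℝ)).sub hgL.coeFn_toLp)]
  have h2 : dist hgL.toLp (h.polyLp k P) ≤ ε / 3 := by
    rw [Lp.dist_def]
    refine ENNReal.toReal_le_of_le_ofReal (by positivity) ?_
    have hPe : (h.polyLp k P : ℝ → ℝ) =ᵐ[weightMeasure ψ a b k k] fun x => P.eval (ψ x) :=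
      hPL.coeFn_toLp
    rw [eLpNorm_congr_ae (hgL.coeFn_toLp.sub hPe)]
    refine (eLpNorm_le_of_ae_bound (C := ε / (3 * (M + 1))) ?_).trans ?_
    · rw [h.ae_weightMeasure_iff]
      filter_upwards [ae_restrict_mem measurableSet_Ioo] with x hx
      exact (hP x (Ioo_subset_Icc_self hx)).le
    · have hfin : weightMeasure ψ a b k k univ ^ (2 : ENNReal).toReal⁻¹ ≠ ⊤ :=
        ENNReal.rpow_ne_top_of_nonneg (by positivity) (measure_ne_top _ _)
      rw [← ENNReal.ofReal_toReal hfin, ← ENNReal.ofReal_mul ENNReal.toReal_nonneg, ← hM]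
      apply ENNReal.ofReal_le_ofReal
      rw [← mul_div_assoc, div_le_div_iff₀ (by positivity) (by positivity)]
      nlinarith
  linarith [dist_triangle y hgL.toLp (h.polyLp k P)]

lemma mem_closure_span_legendrePoly (h : IsScale ψ a b) (k : ℕ)
    (y : Lp ℝ 2 (weightMeasure ψ a b k k)) : y ∈ closure (Submodule.span ℝ
      (Set.range fun n => h.polyLp k (derivative^[k] (legendrePoly ψ a b n))) : Set _) := by
  rw [Metric.mem_closure_iff]
  intro ε hε
  obtain ⟨P, hP⟩ := h.exists_polyLp_near k y hε
  refine ⟨_, ?_, hP⟩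
  have hmem : P ∈ Submodule.span ℝ (Set.range fun n => derivative^[k] (legendrePoly ψ a b n)) := by
    rw [span_iterate_derivative_legendrePoly]; trivial
  have := Submodule.mem_map_of_mem (f := h.polyLp k) hmem
  rw [Submodule.map_span, ← Set.range_comp] at this
  exact this

lemma inner_polyLp (h : IsScale ψ a b) {k : ℕ} (P : ℝ[X]) {f : ℝ → ℝ}
    (hf : MemLp f 2 (weightMeasure ψ a b k k)) :
    inner ℝ (h.polyLp k P) hf.toLp = kappa ψ a b ^ (2 * k + 1) *
      ∫ x in Ioo a b, f x * ((edgePoly ψ a b ^ k * P).eval (ψ x) * deriv ψ x) := by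
  rw [← h.integral_natCast, L2.inner_def]
  refine integral_congr_ae ?_
  filter_upwards [(h.memLp_eval_natCast k P).coeFn_toLp, hf.coeFn_toLp] with x hx1 hx2
  have hx1' : (h.polyLp k P) x = P.eval (ψ x) := hx1
  rw [hx1', hx2]
  rfl

/-- Passing to order `k` multiplies the pairing with `L_n` by the eigenvalue and a constant. The
squared norm of `D^k L_n` gains the same factor, so the Fourier coefficients do not depend on `k`.
-/
lemma inner_polyLp_chain (h : IsScale ψ a b) {z : ℕ → ℝ → ℝ} {k : ℕ}
    (hz : ∀ i < k, IsWeakDelta ψ a b (z i) (z (i + 1)))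
    (hL : ∀ i ≤ k, MemLp (z i) 2 (weightMeasure ψ a b i i)) (n : ℕ) :
    inner ℝ (h.polyLp k (derivative^[k] (legendrePoly ψ a b n))) (hL k le_rfl).toLp
      = kappa ψ a b ^ (2 * k + 1) * legendreEig k n
        * ∫ x in Ioo a b, z 0 x * ((legendrePoly ψ a b n).eval (ψ x) * deriv ψ x) := by
  rw [h.inner_polyLp, h.integral_chain_legendreOp hz hL, h.legendreOp_legendrePoly, mul_assoc]
  congr 1
  rw [← integral_const_mul]
  refine setIntegral_congr_fun measurableSet_Ioo fun x _ => ?_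
  simp only [eval_mul, eval_C]; ring

/-- The previous lemma for the derivatives of `L_j`; it contains both the orthogonality and the
norms. -/
lemma inner_polyLp_legendrePoly (h : IsScale ψ a b) (k i j : ℕ) :
    inner ℝ (h.polyLp k (derivative^[k] (legendrePoly ψ a b i)))
      (h.polyLp k (derivative^[k] (legendrePoly ψ a b j)))
      = kappa ψ a b ^ (2 * k + 1) * legendreEig k i
        * polyInner ψ a b (legendrePoly ψ a b j) (legendrePoly ψ a b i) :=
  h.inner_polyLp_chain (z := fun n x => (derivative^[n] (legendrePoly ψ a b j)).eval (ψ x))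
    (fun n _ => h.isWeakDelta_iterate_derivative _ n) (fun n _ => h.memLp_eval_natCast n _) i

lemma norm_toLp_eq_weightNorm {k : ℕ} {f : ℝ → ℝ}
    (hf : MemLp f 2 (weightMeasure ψ a b k k)) : ‖hf.toLp‖ = weightNorm ψ a b k k f := by
  rw [weightNorm, ← Real.sqrt_sq (norm_nonneg _), ← real_inner_self_eq_norm_sq, L2.inner_def]
  congr 1
  refine integral_congr_ae ?_
  filter_upwards [hf.coeFn_toLp] with x hx
  rw [hx, pow_two]
  rfl

/-- Error estimate for the Legendre projection, in terms of the eigenvalues. -/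
lemma weightNorm_chain_le (h : IsScale ψ a b) {z w : ℕ → ℝ → ℝ} {l m N : ℕ}
    (hz : ∀ i < l, IsWeakDelta ψ a b (z i) (z (i + 1)))
    (hzL : ∀ i ≤ l, MemLp (z i) 2 (weightMeasure ψ a b i i))
    (hw : ∀ i < m, IsWeakDelta ψ a b (w i) (w (i + 1)))
    (hwL : ∀ i ≤ m, MemLp (w i) 2 (weightMeasure ψ a b i i))
    {q : ℝ[X]} (hq : q.natDegree ≤ N)
    (hzw : ∀ᵐ x ∂volume.restrict (Ioo a b), z 0 x = w 0 x - q.eval (ψ x))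
    (horth : ∀ P : ℝ[X], P.natDegree ≤ N →
      ∫ x in Ioo a b, z 0 x * (P.eval (ψ x) * deriv ψ x) = 0)
    {K : ℝ} (hK : 0 ≤ K)
    (hlm : ∀ n, N < n → kappa ψ a b ^ (2 * l + 1) * legendreEig l n
      ≤ K * (kappa ψ a b ^ (2 * m + 1) * legendreEig m n)) :
    weightNorm ψ a b l l (z l) ≤ Real.sqrt K * weightNorm ψ a b m m (w m) := by
  rw [← norm_toLp_eq_weightNorm (hzL l le_rfl), ← norm_toLp_eq_weightNorm (hwL m le_rfl)]
  set L := legendrePoly ψ a b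
  have hself : ∀ n, 0 ≤ polyInner ψ a b (L n) (L n) := fun n =>
    setIntegral_nonneg measurableSet_Ioo fun x hx => by
      rw [← mul_assoc]; exact mul_nonneg (mul_self_nonneg _) (h.deriv_pos hx).le
  -- The Legendre coefficients of `z 0`. They serve for the expansions at both orders `l` and `m`.
  set c : ℕ → ℝ := fun n =>
    (∫ x in Ioo a b, z 0 x * ((L n).eval (ψ x) * deriv ψ x)) / polyInner ψ a b (L n) (L n) with hc
  have hcN : ∀ n, c n ≠ 0 → N < n := by
    intro n hn
    by_contra hle
    exact hn (by simp only [hc, horth (L n)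
      ((natDegree_legendrePoly_le n).trans (not_lt.1 hle)), zero_div])
  have hcmul : ∀ n, ∫ x in Ioo a b, z 0 x * ((L n).eval (ψ x) * deriv ψ x)
      = c n * polyInner ψ a b (L n) (L n) := fun n =>
    (div_mul_cancel₀ _ (h.polyInner_legendrePoly_self_ne_zero n)).symm
  have horth' : ∀ k i j : ℕ, i ≠ j → inner ℝ (h.polyLp k (derivative^[k] (L i)))
      (h.polyLp k (derivative^[k] (L j))) = 0 := fun k i j hij => by
    rw [h.inner_polyLp_legendrePoly, h.polyInner_legendrePoly_ne hij.symm, mul_zero]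
  refine norm_sq_le_of_orthogonal_expansions (e := fun n => h.polyLp l (derivative^[l] (L n)))
    (f := fun n => h.polyLp m (derivative^[m] (L n))) (horth' l) (horth' m)
    (h.mem_closure_span_legendrePoly l _) c (fun n => ?_) (fun n hn => ?_) hK (fun n hn => ?_)
  · rw [h.inner_polyLp_chain hz hzL, ← real_inner_self_eq_norm_sq, h.inner_polyLp_legendrePoly,
      hcmul]
    ring
  · rw [h.inner_polyLp_chain hw hwL, ← real_inner_self_eq_norm_sq, h.inner_polyLp_legendrePoly]
    -- For `n > N` the polynomial `q` is orthogonal to `L n`, so `z 0` and `w 0` have the same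
    -- coefficient.
    have hw0 : ∫ x in Ioo a b, w 0 x * ((L n).eval (ψ x) * deriv ψ x)
        = ∫ x in Ioo a b, z 0 x * ((L n).eval (ψ x) * deriv ψ x) := by
      have e : ∫ x in Ioo a b, z 0 x * ((L n).eval (ψ x) * deriv ψ x)
          = (∫ x in Ioo a b, w 0 x * ((L n).eval (ψ x) * deriv ψ x))
            - polyInner ψ a b q (L n) := by
        rw [polyInner, ← integral_sub (h.integrableOn_mul_eval (k := 0)
          (hwL 0 (Nat.zero_le _)) (by simp)) (h.integrableOn_polyInner _ _)]
        refine integral_congr_ae ?_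
        filter_upwards [hzw] with x hx
        rw [hx]; ring
      rw [e, h.polyInner_legendrePoly_of_degree_lt, sub_zero]
      exact (degree_le_of_natDegree_le hq).trans_lt (by exact_mod_cast hcN n hn)
    rw [hw0, hcmul]
    ring
  · rw [← real_inner_self_eq_norm_sq, ← real_inner_self_eq_norm_sq, h.inner_polyLp_legendrePoly,
      h.inner_polyLp_legendrePoly, ← mul_assoc]
    exact mul_le_mul_of_nonneg_right (hlm n (hcN n hn)) (hself n)

end IsScale

end PsiSpectral

end

noncomputable section

namespace PsiSpectral

open Polynomial Filter Topology

/-! ### Fractional integrals of polynomials -/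

lemma eval_eq_sum_of_comp {N : ℕ} {P A : ℝ[X]} {s t : ℝ} (hP : (P.comp A).natDegree ≤ N)
    (hs : A.eval s = t) :
    P.eval t = ∑ k ∈ Finset.range (N + 1), (P.comp A).coeff k * s ^ k := by
  rw [← eval_eq_sum_range' (by omega), eval_comp, hs]

/-- In powers of `d - t`, the `k`-th term is a Beta integral proportional to `(d - c)^{k+ρ}`. -/
lemma exists_integral_right (d : ℝ) {ρ : ℝ} (hρ : 0 < ρ) {N : ℕ} {Q : ℝ[X]}
    (hQ : Q.natDegree ≤ N) : ∃ R : ℝ[X], R.natDegree ≤ N ∧ ∀ c < d,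
      ∫ t in Ioo c d, (t - c) ^ (ρ - 1) * Q.eval t = (d - c) ^ ρ * R.eval c := by
  set S := Q.comp (C d - X) with hS
  have hSN : S.natDegree ≤ N := by
    rw [hS]
    refine natDegree_comp_le.trans ?_
    have : (C d - X : ℝ[X]).natDegree ≤ 1 := by compute_degree
    nlinarith
  refine ⟨∑ k ∈ Finset.range (N + 1), C (S.coeff k * ∫ s in Ioo (0 : ℝ) 1,
    (1 - s) ^ (k : ℝ) * s ^ (ρ - 1)) * (C d - X) ^ k, ?_, fun c hc => ?_⟩
  · refine natDegree_sum_le_of_forall_le _ _ fun k hk => ?_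
    have : k ≤ N := by simpa [Nat.lt_succ_iff] using hk
    refine le_trans ?_ this
    compute_degree
  · have hd : 0 < d - c := sub_pos.2 hc
    have hpt : ∀ t, (t - c) ^ (ρ - 1) * Q.eval t = ∑ k ∈ Finset.range (N + 1),
        S.coeff k * ((d - t) ^ (k : ℝ) * (t - c) ^ (ρ - 1)) := fun t => by
      rw [eval_eq_sum_of_comp (A := C d - X) (s := d - t) hSN (by simp), Finset.mul_sum]
      refine Finset.sum_congr rfl fun k _ => ?_
      rw [Real.rpow_natCast]; ring
    simp only [hpt]
    rw [integral_finsetSum _ fun k _ => (integrableOn_beta hc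
      (by have := k.cast_nonneg (α := ℝ); linarith) (by linarith)).const_mul _]
    rw [eval_finsetSum, Finset.mul_sum]
    refine Finset.sum_congr rfl fun k _ => ?_
    rw [integral_const_mul, integral_beta_scale hc,
      show (k : ℝ) + (ρ - 1) + 1 = k + ρ by ring, Real.rpow_add hd, Real.rpow_natCast]
    simp only [eval_mul, eval_C, eval_pow, eval_sub, eval_X]
    ring

/-- In powers of `t - c`, the `k`-th term is a Beta integral proportional to `(d - c)^k`: the
singular factor `(t - c)^{-ρ}` exactly offsets the gain of order `ρ`, so no fractional power
remains. -/
lemma exists_integral_left (c : ℝ) {ρ : ℝ} (hρ : 0 < ρ) (hρ1 : ρ < 1) {N : ℕ} {Q : ℝ[X]}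
    (hQ : Q.natDegree ≤ N) : ∃ R : ℝ[X], R.natDegree ≤ N ∧ ∀ d > c,
      ∫ t in Ioo c d, (d - t) ^ (ρ - 1) * ((t - c) ^ (-ρ) * Q.eval t) = R.eval d := by
  set S := Q.comp (X + C c) with hS
  have hSN : S.natDegree ≤ N := by
    rw [hS]
    refine natDegree_comp_le.trans ?_
    have : (X + C c : ℝ[X]).natDegree ≤ 1 := by compute_degree
    nlinarith
  refine ⟨∑ k ∈ Finset.range (N + 1), C (S.coeff k * ∫ s in Ioo (0 : ℝ) 1,
    (1 - s) ^ (ρ - 1) * s ^ (k - ρ)) * (X - C c) ^ k, ?_, fun d hd' => ?_⟩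
  · refine natDegree_sum_le_of_forall_le _ _ fun k hk => ?_
    have : k ≤ N := by simpa [Nat.lt_succ_iff] using hk
    refine le_trans ?_ this
    compute_degree
  · have hd : 0 < d - c := sub_pos.2 hd'
    have hpt : ∀ t ∈ Ioo c d, (d - t) ^ (ρ - 1) * ((t - c) ^ (-ρ) * Q.eval t)
        = ∑ k ∈ Finset.range (N + 1),
        S.coeff k * ((d - t) ^ (ρ - 1) * (t - c) ^ (k - ρ)) := fun t ht => by
      rw [eval_eq_sum_of_comp (A := X + C c) (s := t - c) hSN (by simp), Finset.mul_sum,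
        Finset.mul_sum]
      refine Finset.sum_congr rfl fun k _ => ?_
      rw [sub_eq_add_neg (k : ℝ) ρ, Real.rpow_add (sub_pos.2 ht.1), Real.rpow_natCast]; ring
    rw [setIntegral_congr_fun measurableSet_Ioo hpt]
    rw [integral_finsetSum _ fun k _ => (integrableOn_beta hd' (by linarith)
      (by have := k.cast_nonneg (α := ℝ); linarith)).const_mul _]
    rw [eval_finsetSum]
    refine Finset.sum_congr rfl fun k _ => ?_
    rw [integral_const_mul, integral_beta_scale hd',
      show ρ - 1 + ((k : ℝ) - ρ) + 1 = k by ring, Real.rpow_natCast]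
    simp only [eval_mul, eval_C, eval_pow, eval_sub, eval_X]
    ring

/-- The kernel of the fractional integral, extended by zero to `τ ≥ x`. -/
def psiKernel (ψ : ℝ → ℝ) (ρ : ℝ) (f : ℝ → ℝ) (x τ : ℝ) : ℝ :=
  (Iio x).indicator (fun τ => deriv ψ τ * (ψ x - ψ τ) ^ (ρ - 1) * f τ) τ

namespace IsScale

variable {ψ : ℝ → ℝ} {a b : ℝ}

lemma psiIntegral_eq {ρ : ℝ} (f : ℝ → ℝ) {x : ℝ} (hx : x ∈ Ioo a b) :
    psiIntegral ψ a ρ f x = 1 / Real.Gamma ρ * ∫ τ in Ioo a b, psiKernel ψ ρ f x τ := by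
  have : Ioo a b ∩ Iio x = Ioo a x := by
    ext y; exact ⟨fun hy => ⟨hy.1.1, hy.2⟩, fun hy => ⟨⟨hy.1, hy.2.trans hx.2⟩, hy.2⟩⟩
  simp only [psiIntegral, psiKernel]
  rw [setIntegral_indicator measurableSet_Iio, this, intervalIntegral.integral_of_le hx.1.le,
    integral_Ioc_eq_integral_Ioo]

lemma exists_psiIntegral_poly (h : IsScale ψ a b) {ρ : ℝ} (hρ : 0 < ρ) (hρ1 : ρ < 1) {N : ℕ}
    {P : ℝ[X]} (hP : P.natDegree ≤ N) : ∃ R : ℝ[X], R.natDegree ≤ N ∧ ∀ x ∈ Ioo a b,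
      psiIntegral ψ a ρ (fun x => (ψ x - ψ a) ^ (-ρ) * P.eval (ψ x)) x = R.eval (ψ x) := by
  obtain ⟨R, hR, hRe⟩ := exists_integral_left (ψ a) hρ hρ1 hP
  refine ⟨C (1 / Real.Gamma ρ) * R, (natDegree_C_mul_le _ _).trans hR, fun x hx => ?_⟩
  rw [psiIntegral, intervalIntegral.integral_of_le hx.1.le, integral_Ioc_eq_integral_Ioo, eval_mul,
    eval_C, ← hRe _ (h.left_lt hx), ← h.integral_comp le_rfl hx.1.le hx.2.le]
  congr 1
  refine setIntegral_congr_fun measurableSet_Ioo fun τ _ => ?_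
  ring

lemma aestronglyMeasurable_psiKernel (h : IsScale ψ a b) {ρ : ℝ} {f : ℝ → ℝ}
    (hf : IntegrableOn (fun x => f x * deriv ψ x) (Ioo a b)) :
    AEStronglyMeasurable (fun p : ℝ × ℝ => psiKernel ψ ρ f p.1 p.2 * deriv ψ p.1)
      ((volume.restrict (Ioo a b)).prod (volume.restrict (Ioo a b))) := by
  have h1 := h.aestronglyMeasurable.comp_fst (ν := volume.restrict (Ioo a b))
  have h2 := h.aestronglyMeasurable.comp_snd (μ := volume.restrict (Ioo a b))
  have h3 := h.aestronglyMeasurable_deriv.comp_fst (ν := volume.restrict (Ioo a b))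
  have h4 := hf.aestronglyMeasurable.comp_snd (μ := volume.restrict (Ioo a b))
  have h5 : AEStronglyMeasurable (fun p : ℝ × ℝ => (ψ p.1 - ψ p.2) ^ (ρ - 1))
      ((volume.restrict (Ioo a b)).prod (volume.restrict (Ioo a b))) :=
    ((h1.aemeasurable.sub h2.aemeasurable).pow_const (ρ - 1)).aestronglyMeasurable
  refine (((h5.mul h4).indicator (measurableSet_lt measurable_snd measurable_fst)).mul
    h3).congr (Eventually.of_forall fun p => ?_)
  by_cases hp : p.2 < p.1
  · simp only [psiKernel, Pi.mul_apply, indicator, mem_ofPred_eq, mem_Iio, hp, if_true]; ring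
  · simp [psiKernel, hp]

lemma psiKernel_mul_eq_indicator {ρ : ℝ} {f : ℝ → ℝ} (τ : ℝ) (x : ℝ) :
    psiKernel ψ ρ f x τ * deriv ψ x = (Ioi τ).indicator
      (fun x => (f τ * deriv ψ τ) * ((ψ x - ψ τ) ^ (ρ - 1) * deriv ψ x)) x := by
  by_cases hx : τ < x
  · simp [psiKernel, hx]; ring
  · simp [psiKernel, hx]

lemma inter_Ioi {τ : ℝ} (hτ : τ ∈ Ioo a b) : Ioo a b ∩ Ioi τ = Ioo τ b := by
  ext y; exact ⟨fun hy => ⟨hy.2, hy.1.2⟩, fun hy => ⟨⟨hτ.1.trans hy.1, hy.2⟩, hy.1⟩⟩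

lemma integrableOn_right_kernel (h : IsScale ψ a b) {ρ : ℝ} (hρ : 0 < ρ) {τ : ℝ}
    (hτ : τ ∈ Ioo a b) : IntegrableOn (fun x => (ψ x - ψ τ) ^ (ρ - 1) * deriv ψ x) (Ioo τ b) := by
  have hb := integrableOn_beta (h.lt_right hτ) (show (-1 : ℝ) < 0 by norm_num)
    (show -1 < ρ - 1 by linarith)
  have := h.integrableOn_comp hτ.1.le hτ.2.le le_rfl hb
  simpa using this

/-- Tonelli: for fixed `τ`, integrating the kernel in `x` against `dψ` gives a multiple of `(ψ(b) -
ψ(τ))^ρ`, which is bounded, times the integrable `f ψ'`. -/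
lemma integrable_psiKernel (h : IsScale ψ a b) {ρ : ℝ} (hρ : 0 < ρ) {f : ℝ → ℝ}
    (hf : IntegrableOn (fun x => f x * deriv ψ x) (Ioo a b)) :
    Integrable (fun p : ℝ × ℝ => psiKernel ψ ρ f p.1 p.2 * deriv ψ p.1)
      ((volume.restrict (Ioo a b)).prod (volume.restrict (Ioo a b))) := by
  rw [integrable_prod_iff' (h.aestronglyMeasurable_psiKernel hf)]
  simp only [psiKernel_mul_eq_indicator, norm_indicator_eq_indicator_norm]
  constructor
  · filter_upwards [ae_restrict_mem measurableSet_Ioo] with τ hτ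
    rw [integrable_indicator_iff measurableSet_Ioi, IntegrableOn,
      Measure.restrict_restrict measurableSet_Ioi, inter_comm, inter_Ioi hτ]
    exact (h.integrableOn_right_kernel hρ hτ).const_mul _
  · obtain ⟨R, -, hR⟩ := exists_integral_right (ψ b) hρ (Q := 1) (N := 0) (by simp)
    have hbound : IntegrableOn (fun τ => ((ψ b - ψ τ) ^ ρ * R.eval (ψ τ)) * (f τ * deriv ψ τ))
        (Ioo a b) := by
      have hc : ContinuousOn (fun τ => (ψ b - ψ τ) ^ ρ * R.eval (ψ τ)) (Icc a b) :=
        ((continuousOn_const.sub h.continuousOn).rpow_const fun _ _ => Or.inr hρ.le).mul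
          (h.continuousOn_eval R)
      obtain ⟨M, hM⟩ := isCompact_Icc.exists_bound_of_continuousOn hc
      refine hf.bdd_mul (c := M)
        ((hc.mono Ioo_subset_Icc_self).aestronglyMeasurable measurableSet_Ioo) ?_
      filter_upwards [ae_restrict_mem measurableSet_Ioo] with x hx
      exact hM x (Ioo_subset_Icc_self hx)
    refine hbound.norm.congr ?_
    filter_upwards [ae_restrict_mem measurableSet_Ioo] with τ hτ
    rw [setIntegral_indicator measurableSet_Ioi, inter_Ioi hτ]
    have e1 := h.integral_comp hτ.1.le hτ.2.le le_rfl (fun t => (t - ψ τ) ^ (ρ - 1))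
    have e2 := hR (ψ τ) (h.lt_right hτ)
    simp only [eval_one, mul_one] at e2
    rw [e2] at e1
    have hpos : 0 ≤ (ψ b - ψ τ) ^ ρ * R.eval (ψ τ) := by
      rw [← e1]
      refine setIntegral_nonneg measurableSet_Ioo fun x hx => ?_
      exact mul_nonneg (Real.rpow_nonneg (sub_nonneg.2 (h.strictMonoOn.monotoneOn
        (Ioo_subset_Icc_self hτ) ⟨(hτ.1.trans hx.1).le, hx.2.le⟩ hx.1.le)) _)
        (h.deriv_pos ⟨hτ.1.trans hx.1, hx.2⟩).le
    rw [norm_mul, Real.norm_of_nonneg hpos, ← e1, mul_comm, ← integral_const_mul]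
    refine setIntegral_congr_fun measurableSet_Ioo fun x hx => ?_
    simp only [norm_mul]
    rw [Real.norm_of_nonneg (Real.rpow_nonneg (sub_nonneg.2 (h.strictMonoOn.monotoneOn
        (Ioo_subset_Icc_self hτ) ⟨(hτ.1.trans hx.1).le, hx.2.le⟩ hx.1.le)) _),
      Real.norm_of_nonneg (h.deriv_pos ⟨hτ.1.trans hx.1, hx.2⟩).le]

lemma ae_integrableOn_psiKernel (h : IsScale ψ a b) {ρ : ℝ} (hρ : 0 < ρ) {f : ℝ → ℝ}
    (hf : IntegrableOn (fun x => f x * deriv ψ x) (Ioo a b)) :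
    ∀ᵐ x ∂volume.restrict (Ioo a b), IntegrableOn (psiKernel ψ ρ f x) (Ioo a b) := by
  filter_upwards [(h.integrable_psiKernel hρ hf).prod_right_ae,
    ae_restrict_mem measurableSet_Ioo] with x hx hxI
  refine (hx.mul_const (deriv ψ x)⁻¹).congr (Eventually.of_forall fun τ => ?_)
  have := (h.deriv_pos hxI).ne'
  simp only []
  field_simp

/-- The identity holds only almost everywhere: for `f` integrable against `dψ`, Fubini gives
convergence of the fractional integral at almost every point. -/
lemma psiIntegral_sub_ae (h : IsScale ψ a b) {ρ : ℝ} (hρ : 0 < ρ) {f g : ℝ → ℝ}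
    (hf : IntegrableOn (fun x => f x * deriv ψ x) (Ioo a b))
    (hg : IntegrableOn (fun x => g x * deriv ψ x) (Ioo a b)) :
    ∀ᵐ x ∂volume.restrict (Ioo a b), psiIntegral ψ a ρ (fun x => f x - g x) x
      = psiIntegral ψ a ρ f x - psiIntegral ψ a ρ g x := by
  filter_upwards [h.ae_integrableOn_psiKernel hρ hf, h.ae_integrableOn_psiKernel hρ hg,
    ae_restrict_mem measurableSet_Ioo] with x hxf hxg hx
  rw [psiIntegral_eq _ hx, psiIntegral_eq _ hx, psiIntegral_eq _ hx, ← mul_sub,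
    ← integral_sub hxf hxg]
  congr 2
  ext τ
  by_cases hτ : τ < x
  · simp [psiKernel, hτ]; ring
  · simp [psiKernel, hτ]

/-- By Fubini, the adjoint of the left-sided fractional integral is the right-sided one, evaluated
on `Q(ψ)` by `exists_integral_right`. The polynomial `R` must be independent of `f`, since it
selects the test element of `E_N`. -/
lemma exists_integral_psiIntegral (h : IsScale ψ a b) {ρ : ℝ} (hρ : 0 < ρ) {N : ℕ} {Q : ℝ[X]}
    (hQ : Q.natDegree ≤ N) : ∃ R : ℝ[X], R.natDegree ≤ N ∧ ∀ f : ℝ → ℝ,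
      IntegrableOn (fun x => f x * deriv ψ x) (Ioo a b) →
      ∫ x in Ioo a b, psiIntegral ψ a ρ f x * (Q.eval (ψ x) * deriv ψ x)
        = 1 / Real.Gamma ρ
          * ∫ τ in Ioo a b, f τ * deriv ψ τ * ((ψ b - ψ τ) ^ ρ * R.eval (ψ τ)) := by
  obtain ⟨R, hR, hRe⟩ := exists_integral_right (ψ b) hρ hQ
  refine ⟨R, hR, fun f hf => ?_⟩
  have hint : Integrable (fun p : ℝ × ℝ => Q.eval (ψ p.1) * (psiKernel ψ ρ f p.1 p.2
      * deriv ψ p.1)) ((volume.restrict (Ioo a b)).prod (volume.restrict (Ioo a b))) := by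
    obtain ⟨M, hM⟩ := h.exists_bound_eval Q
    refine (h.integrable_psiKernel hρ hf).bdd_mul (c := M) (AEStronglyMeasurable.comp_fst
      (((h.continuousOn_eval Q).mono Ioo_subset_Icc_self).aestronglyMeasurable
      measurableSet_Ioo)) ?_
    rw [Measure.prod_restrict]
    filter_upwards [ae_restrict_mem (measurableSet_Ioo.prod measurableSet_Ioo)] with p hp
    exact hM p.1 (Ioo_subset_Icc_self hp.1)
  have hswap := integral_integral_swap (f := fun x τ => Q.eval (ψ x) * (psiKernel ψ ρ f x τ
      * deriv ψ x)) hint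
  have e1 : ∫ x in Ioo a b, psiIntegral ψ a ρ f x * (Q.eval (ψ x) * deriv ψ x)
      = 1 / Real.Gamma ρ * ∫ x in Ioo a b, ∫ τ in Ioo a b,
        Q.eval (ψ x) * (psiKernel ψ ρ f x τ * deriv ψ x) := by
    rw [← integral_const_mul]
    refine setIntegral_congr_fun measurableSet_Ioo fun x hx => ?_
    simp only [psiIntegral_eq f hx, integral_const_mul, integral_mul_const]
    ring
  rw [e1, hswap]
  congr 1
  refine setIntegral_congr_fun measurableSet_Ioo fun τ hτ => ?_
  have hs : ∀ x, Q.eval (ψ x) * (psiKernel ψ ρ f x τ * deriv ψ x) = (Ioi τ).indicator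
      (fun x => (f τ * deriv ψ τ) * (((ψ x - ψ τ) ^ (ρ - 1) * Q.eval (ψ x)) * deriv ψ x)) x := by
    intro x
    rw [psiKernel_mul_eq_indicator]
    by_cases hx : τ < x
    · simp [hx]; ring
    · simp [hx]
  simp only [hs]
  rw [setIntegral_indicator measurableSet_Ioi, inter_Ioi hτ, integral_const_mul,
    h.integral_comp hτ.1.le hτ.2.le le_rfl (fun t => (t - ψ τ) ^ (ρ - 1) * Q.eval t),
    hRe _ (h.lt_right hτ)]

/-! ### Integrability with respect to the weight of exponents `ρ, ρ` -/

/-- Cauchy–Schwarz against the reciprocal of the weight relative to `dψ`. Its square integrability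
amounts to that of the Beta weight with exponents `-ρ`, and `-ρ > -1`. -/
lemma integrableOn_mul_deriv_of_memLp (h : IsScale ψ a b) {ρ : ℝ} (hρ1 : ρ < 1)
    {u : ℝ → ℝ} (hu : MemLp u 2 (weightMeasure ψ a b ρ ρ)) :
    IntegrableOn (fun x => u x * deriv ψ x) (Ioo a b) := by
  have hg : MemLp (fun x => (ψ b - ψ x) ^ (-ρ) * (ψ x - ψ a) ^ (-ρ)) 2
      (weightMeasure ψ a b ρ ρ) := by
    have hm := h.aestronglyMeasurable.aemeasurable
    refine (h.memLp_weightMeasure_iff ρ ρ).2 ⟨AEMeasurable.aestronglyMeasurable (by fun_prop), ?_⟩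
    refine IntegrableOn.congr_fun ((h.integrableOn_weight (α := -ρ) (β := -ρ) (by linarith)
      (by linarith)).const_mul (kappa ψ a b ^ (ρ + ρ + 1) * (kappa ψ a b ^ (-ρ + -ρ + 1))⁻¹))
      (fun x hx => ?_) measurableSet_Ioo
    have h1 : 0 < ψ x - ψ a := sub_pos.2 (h.left_lt hx)
    have h2 : 0 < ψ b - ψ x := sub_pos.2 (h.lt_right hx)
    have h3 := Real.rpow_pos_of_pos h.kappa_pos (-ρ + -ρ + 1)
    have h4 := (Real.rpow_pos_of_pos h1 ρ).ne'
    have h5 := (Real.rpow_pos_of_pos h2 ρ).ne'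
    simp only [weight, Real.rpow_neg h1.le, Real.rpow_neg h2.le]
    generalize kappa ψ a b ^ (-ρ + -ρ + 1) = K at h3 ⊢
    field_simp
  have hk := Real.rpow_pos_of_pos h.kappa_pos (ρ + ρ + 1)
  refine IntegrableOn.congr_fun ((h.integrableOn_mul_of_memLp hu hg).const_mul
    (kappa ψ a b ^ (ρ + ρ + 1))⁻¹) (fun x hx => ?_) measurableSet_Ioo
  have h1 : 0 < ψ x - ψ a := sub_pos.2 (h.left_lt hx)
  have h2 : 0 < ψ b - ψ x := sub_pos.2 (h.lt_right hx)
  have h4 := (Real.rpow_pos_of_pos h1 ρ).ne'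
  have h5 := (Real.rpow_pos_of_pos h2 ρ).ne'
  simp only [weight, Real.rpow_neg h1.le, Real.rpow_neg h2.le]
  generalize kappa ψ a b ^ (ρ + ρ + 1) = K at hk ⊢
  field_simp

/-- Squaring and multiplying by the weight leaves the exponent `-ρ > -1` at the left end point, that
is, the weight `ϖ^{ρ,-ρ}` up to a constant. -/
lemma memLp_rpow_mul_eval (h : IsScale ψ a b) {ρ : ℝ} (hρ : 0 < ρ) (hρ1 : ρ < 1) (P : ℝ[X]) :
    MemLp (fun x => (ψ x - ψ a) ^ (-ρ) * P.eval (ψ x)) 2 (weightMeasure ψ a b ρ ρ) := by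
  have hm := h.aestronglyMeasurable.aemeasurable
  have hP := ((h.continuousOn_eval P).mono Ioo_subset_Icc_self).aestronglyMeasurable
    (μ := volume) measurableSet_Ioo
  refine (h.memLp_weightMeasure_iff ρ ρ).2 ⟨AEStronglyMeasurable.mul
    (AEMeasurable.aestronglyMeasurable (by fun_prop)) hP, ?_⟩
  have hint := ((h.memLp_weightMeasure_iff _ _).1
    (h.memLp_eval (α := ρ) (β := -ρ) (by linarith) (by linarith) P)).2
  refine IntegrableOn.congr_fun (hint.const_mul
    (kappa ψ a b ^ (ρ + ρ + 1) * (kappa ψ a b ^ (ρ + -ρ + 1))⁻¹)) (fun x hx => ?_) measurableSet_Ioo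
  have h1 : 0 < ψ x - ψ a := sub_pos.2 (h.left_lt hx)
  have h3 := Real.rpow_pos_of_pos h.kappa_pos (ρ + -ρ + 1)
  have h4 := (Real.rpow_pos_of_pos h1 ρ).ne'
  simp only [weight, Real.rpow_neg h1.le]
  generalize kappa ψ a b ^ (ρ + -ρ + 1) = K at h3 ⊢
  field_simp

/-- The power `(ψ - ψ(a))^{-ρ}` cancels the left factor of the weight, leaving the function produced
by the adjoint of the fractional integral. -/
lemma integral_mul_rpow_mul_eval (h : IsScale ψ a b) {ρ : ℝ} (f : ℝ → ℝ) (R : ℝ[X]) :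
    ∫ x, f x * ((ψ x - ψ a) ^ (-ρ) * R.eval (ψ x)) ∂weightMeasure ψ a b ρ ρ
      = kappa ψ a b ^ (ρ + ρ + 1)
        * ∫ x in Ioo a b, f x * deriv ψ x * ((ψ b - ψ x) ^ ρ * R.eval (ψ x)) := by
  rw [h.integral_weightMeasure, ← integral_const_mul]
  refine setIntegral_congr_fun measurableSet_Ioo fun x hx => ?_
  have h1 : 0 < ψ x - ψ a := sub_pos.2 (h.left_lt hx)
  have h4 := (Real.rpow_pos_of_pos h1 ρ).ne'
  simp only [weight, Real.rpow_neg h1.le]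
  field_simp

end IsScale

end PsiSpectral

end

/-! ### The projection onto `E_N` and its image under the fractional integral. -/

noncomputable section

namespace PsiSpectral

open Polynomial Filter Topology

lemma mem_spaceF_iff {ψ : ℝ → ℝ} {N : ℕ} {φ : ℝ → ℝ} :
    φ ∈ spaceF ψ N ↔ ∃ P : ℝ[X], P.natDegree ≤ N ∧ φ = fun x => P.eval (ψ x) := by
  constructor
  · intro hφ
    induction hφ using Submodule.span_induction with
    | mem x hx =>
      obtain ⟨i, hi, rfl⟩ := hx
      exact ⟨X ^ i, (natDegree_X_pow_le i).trans hi, by simp⟩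
    | zero => exact ⟨0, by simp, by ext; simp⟩
    | add x y _ _ hx hy =>
      obtain ⟨P, hP, rfl⟩ := hx
      obtain ⟨Q, hQ, rfl⟩ := hy
      exact ⟨P + Q, natDegree_add_le_of_degree_le hP hQ, by ext; simp⟩
    | smul c x _ hx =>
      obtain ⟨P, hP, rfl⟩ := hx
      exact ⟨C c * P, (natDegree_C_mul_le _ _).trans hP, by ext; simp⟩
  · rintro ⟨P, hP, rfl⟩
    have : (fun x => P.eval (ψ x))
        = ∑ i ∈ Finset.range (N + 1), P.coeff i • fun x => ψ x ^ i := by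
      ext x
      rw [eval_eq_sum_range' (show P.natDegree < N + 1 by omega)]
      simp
    rw [this]
    refine Submodule.sum_mem _ fun i hi => Submodule.smul_mem _ _ (Submodule.subset_span ⟨i, ?_, rfl⟩)
    exact Nat.lt_succ_iff.1 (Finset.mem_range.1 hi)

lemma mem_spaceE_iff {ψ : ℝ → ℝ} {a ρ : ℝ} {N : ℕ} {v : ℝ → ℝ} :
    v ∈ spaceE ψ a ρ N ↔
      ∃ P : ℝ[X], P.natDegree ≤ N ∧ v = fun x => (ψ x - ψ a) ^ (-ρ) * P.eval (ψ x) := by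
  constructor
  · rintro ⟨φ, hφ, rfl⟩
    obtain ⟨P, hP, rfl⟩ := mem_spaceF_iff.1 hφ
    exact ⟨P, hP, rfl⟩
  · rintro ⟨P, hP, rfl⟩
    exact ⟨_, mem_spaceF_iff.2 ⟨P, hP, rfl⟩, rfl⟩

namespace IsScale

variable {ψ : ℝ → ℝ} {a b : ℝ}

/-- The map `P ↦ (ψ - ψ(a))^{-ρ} P(ψ)` into `L²`. -/
def singularLp (h : IsScale ψ a b) {ρ : ℝ} (hρ : 0 < ρ) (hρ1 : ρ < 1) :
    ℝ[X] →ₗ[ℝ] Lp ℝ 2 (weightMeasure ψ a b ρ ρ) where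
  toFun P := (h.memLp_rpow_mul_eval hρ hρ1 P).toLp
  map_add' P Q := by
    rw [← MemLp.toLp_add]
    congr 1
    ext x
    simp [mul_add]
  map_smul' c P := by
    rw [RingHom.id_apply, ← MemLp.toLp_const_smul]
    congr 1
    ext x
    simp only [eval_smul, smul_eq_mul, Pi.smul_apply]
    ring

lemma inner_singularLp (h : IsScale ψ a b) {ρ : ℝ} (hρ : 0 < ρ) (hρ1 : ρ < 1) (Q : ℝ[X])
    {f : ℝ → ℝ} (hf : MemLp f 2 (weightMeasure ψ a b ρ ρ)) :
    inner ℝ (h.singularLp hρ hρ1 Q) hf.toLp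
      = ∫ x, f x * ((ψ x - ψ a) ^ (-ρ) * Q.eval (ψ x)) ∂weightMeasure ψ a b ρ ρ := by
  rw [L2.inner_def]
  refine integral_congr_ae ?_
  filter_upwards [(h.memLp_rpow_mul_eval hρ hρ1 Q).coeFn_toLp, hf.coeFn_toLp] with x hx1 hx2
  have hx1' : (h.singularLp hρ hρ1 Q) x = (ψ x - ψ a) ^ (-ρ) * Q.eval (ψ x) := hx1
  rw [hx1', hx2]
  rfl

lemma eq_zero_of_singularLp_eq_zero (h : IsScale ψ a b) {ρ : ℝ} (hρ : 0 < ρ) (hρ1 : ρ < 1)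
    {P : ℝ[X]} (hP : h.singularLp hρ hρ1 P = 0) : P = 0 := by
  apply h.eq_zero_of_ae_eval_eq_zero
  have h1 : (h.singularLp hρ hρ1 P : ℝ → ℝ) =ᵐ[weightMeasure ψ a b ρ ρ] _ :=
    (h.memLp_rpow_mul_eval hρ hρ1 P).coeFn_toLp
  rw [hP] at h1
  have h2 := (h.ae_weightMeasure_iff ρ ρ).1 ((Lp.coeFn_zero ℝ 2 _).symm.trans h1)
  filter_upwards [h2, ae_restrict_mem measurableSet_Ioo] with x hx hxI
  have := (Real.rpow_pos_of_pos (sub_pos.2 (h.left_lt hxI)) (-ρ)).ne'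
  simpa [this] using hx.symm

lemma isProjE_iff (h : IsScale ψ a b) {ρ : ℝ} (hρ : 0 < ρ) (hρ1 : ρ < 1) {N : ℕ} {u p : ℝ → ℝ}
    (hu : MemLp u 2 (weightMeasure ψ a b ρ ρ)) : IsProjE ψ a b ρ N u p ↔
      ∃ P : ℝ[X], P.natDegree ≤ N ∧ (p = fun x => (ψ x - ψ a) ^ (-ρ) * P.eval (ψ x)) ∧
        ∀ Q : ℝ[X], Q.natDegree ≤ N →
          inner ℝ (h.singularLp hρ hρ1 Q) (hu.toLp - h.singularLp hρ hρ1 P) = 0 := by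
  have key : ∀ P Q : ℝ[X], inner ℝ (h.singularLp hρ hρ1 Q) (hu.toLp - h.singularLp hρ hρ1 P)
      = ∫ x, (u x - (ψ x - ψ a) ^ (-ρ) * P.eval (ψ x)) * ((ψ x - ψ a) ^ (-ρ) * Q.eval (ψ x))
        ∂weightMeasure ψ a b ρ ρ := fun P Q => by
    exact h.inner_singularLp hρ hρ1 Q (hu.sub (h.memLp_rpow_mul_eval hρ hρ1 P))
  constructor
  · rintro ⟨hp, ho⟩
    obtain ⟨P, hP, rfl⟩ := mem_spaceE_iff.1 hp
    exact ⟨P, hP, rfl, fun Q hQ => (key P Q).trans (ho _ (mem_spaceE_iff.2 ⟨Q, hQ, rfl⟩))⟩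
  · rintro ⟨P, hP, rfl, ho⟩
    refine ⟨mem_spaceE_iff.2 ⟨P, hP, rfl⟩, fun v hv => ?_⟩
    obtain ⟨Q, hQ, rfl⟩ := mem_spaceE_iff.1 hv
    exact (key P Q).symm.trans (ho Q hQ)

/-- Hilbert space projection onto a finite-dimensional subspace. Uniqueness holds for functions on
all of `ℝ`, not only almost everywhere, because the polynomial `P` is determined by its class in
`L²`. -/
lemma existsUnique_isProjE (h : IsScale ψ a b) {ρ : ℝ} (hρ : 0 < ρ) (hρ1 : ρ < 1) (N : ℕ)
    {u : ℝ → ℝ} (hu : MemLp u 2 (weightMeasure ψ a b ρ ρ)) :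
    ∃! p : ℝ → ℝ, IsProjE ψ a b ρ N u p := by
  have hmem : ∀ Q : ℝ[X], Q ∈ degreeLE ℝ N ↔ Q.natDegree ≤ N := fun Q => by
    rw [mem_degreeLE, natDegree_le_iff_degree_le]
  have hfin : FiniteDimensional ℝ (degreeLE ℝ (N : WithBot ℕ)) := by
    rw [← degreeLT_succ_eq_degreeLE]
    exact (degreeLTEquiv ℝ (N + 1)).symm.finiteDimensional
  let S := (degreeLE ℝ (N : WithBot ℕ)).map (h.singularLp hρ hρ1)
  obtain ⟨P, hP, hPe⟩ := Submodule.mem_map.1 (S.starProjection_apply_mem hu.toLp)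
  refine ⟨_, (h.isProjE_iff hρ hρ1 hu).2 ⟨P, (hmem P).1 hP, rfl, fun Q hQ => ?_⟩, fun p hp => ?_⟩
  · rw [hPe]
    exact S.sub_starProjection_mem_orthogonal hu.toLp _ (Submodule.mem_map_of_mem ((hmem Q).2 hQ))
  · obtain ⟨P', hP', rfl, ho⟩ := (h.isProjE_iff hρ hρ1 hu).1 hp
    have hdeg : (P' - P).natDegree ≤ N :=
      (natDegree_sub_le _ _).trans (max_le hP' ((hmem P).1 hP))
    have h1 := ho (P' - P) hdeg
    have h2 : inner ℝ (h.singularLp hρ hρ1 (P' - P)) (hu.toLp - h.singularLp hρ hρ1 P) = 0 := by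
      rw [hPe]
      exact S.sub_starProjection_mem_orthogonal hu.toLp _
        (Submodule.mem_map_of_mem ((hmem _).2 hdeg))
    have h3 : inner ℝ (h.singularLp hρ hρ1 (P' - P)) (h.singularLp hρ hρ1 (P' - P)) = 0 := by
      nth_rewrite 2 [show h.singularLp hρ hρ1 (P' - P) = (hu.toLp - h.singularLp hρ hρ1 P)
        - (hu.toLp - h.singularLp hρ hρ1 P') by rw [map_sub]; abel]
      rw [inner_sub_right, h1, h2, sub_zero]
    rw [sub_eq_zero.1 (h.eq_zero_of_singularLp_eq_zero hρ hρ1 (inner_self_eq_zero.1 h3))]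

/-- Fractional integration turns the projection onto `E_N` into the Legendre projection. -/
lemma psiIntegral_sub_isProjE (h : IsScale ψ a b) {ρ : ℝ} (hρ : 0 < ρ) (hρ1 : ρ < 1) {N : ℕ}
    {u p : ℝ → ℝ} (hu : MemLp u 2 (weightMeasure ψ a b ρ ρ)) (hp : IsProjE ψ a b ρ N u p) :
    (∃ q : ℝ[X], q.natDegree ≤ N ∧ ∀ᵐ x ∂volume.restrict (Ioo a b),
      psiIntegral ψ a ρ (fun x => u x - p x) x = psiIntegral ψ a ρ u x - q.eval (ψ x)) ∧
    ∀ Q : ℝ[X], Q.natDegree ≤ N →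
      ∫ x in Ioo a b, psiIntegral ψ a ρ (fun x => u x - p x) x * (Q.eval (ψ x) * deriv ψ x)
        = 0 := by
  obtain ⟨P, hP, hpP⟩ := mem_spaceE_iff.1 hp.1
  have hpL : MemLp p 2 (weightMeasure ψ a b ρ ρ) := hpP ▸ h.memLp_rpow_mul_eval hρ hρ1 P
  constructor
  · obtain ⟨q, hq, hqe⟩ := h.exists_psiIntegral_poly hρ hρ1 hP
    refine ⟨q, hq, ?_⟩
    filter_upwards [h.psiIntegral_sub_ae hρ (h.integrableOn_mul_deriv_of_memLp hρ1 hu)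
      (h.integrableOn_mul_deriv_of_memLp hρ1 hpL), ae_restrict_mem measurableSet_Ioo] with x hx hxI
    rw [hx, hpP, hqe x hxI]
  · intro Q hQ
    obtain ⟨R, hR, hRe⟩ := h.exists_integral_psiIntegral hρ hQ
    -- Testing the projection against `(ψ - ψ(a))^{-ρ} R(ψ)`, which lies in `E_N` because `deg R ≤
    -- N`.
    have h1 := hp.2 _ (mem_spaceE_iff.2 ⟨R, hR, rfl⟩)
    rw [h.integral_mul_rpow_mul_eval (fun x => u x - p x) R] at h1
    rw [hRe (fun x => u x - p x) (h.integrableOn_mul_deriv_of_memLp hρ1 (hu.sub hpL)),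
      (mul_eq_zero.1 h1).resolve_left (Real.rpow_pos_of_pos h.kappa_pos _).ne', mul_zero]

end IsScale

/-! ### Fractional derivatives as integer ones, and ratios of eigenvalues. -/

lemma isPsiDeriv_iff {ψ : ℝ → ℝ} {a b ρ : ℝ} (hρ : 0 < ρ) (hρ1 : ρ < 1) {l : ℕ} (hl : 1 ≤ l)
    {f g : ℝ → ℝ} : IsPsiDeriv ψ a b ((l : ℝ) - ρ) f g ↔
      IsWeakDeltaPow ψ a b l (psiIntegral ψ a ρ f) g := by
  -- As `l - 1 < l - ρ < l`, the integer order is `l` and the remaining integral has order `ρ`,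
  -- whatever `l` is.
  have hceil : ⌈(l : ℝ) - ρ⌉₊ = l := by
    rw [Nat.ceil_eq_iff (by omega)]
    refine ⟨?_, by linarith⟩
    rw [Nat.cast_sub hl]
    push_cast
    linarith
  rw [IsPsiDeriv, hceil, sub_sub_cancel]

/-- The ratio of the eigenvalues of orders `m` and `l` is a product of two descending factorials of
length `m - l`. The one starting at `n + m` is at least `N^{m-l}`. The one starting at `n - l` is at
least `(n - m + 1)^{m-l}`, and `N ≤ m (n - m + 1)`; this is the origin of `m^{m-l}`. The condition
`m ≤ N + 1` ensures `m ≤ n`. -/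
lemma pow_mul_legendreEig_le {l m N n : ℕ} (hl : 1 ≤ l) (hlm : l ≤ m) (hm : m ≤ N + 1)
    (hn : N < n) :
    N ^ (2 * (m - l)) * legendreEig l n ≤ m ^ (m - l) * legendreEig m n := by
  have hmn : m ≤ n := by omega
  have e1 : (n - l).descFactorial (m - l) * n.descFactorial l = n.descFactorial m :=
    Nat.descFactorial_mul_descFactorial hlm
  have e2 : (n + l).descFactorial l * (n + m).descFactorial (m - l)
      = (n + m).descFactorial m := by
    have := Nat.descFactorial_mul_descFactorial (n := n + m) (Nat.sub_le m l)
    rwa [show n + m - (m - l) = n + l by omega, Nat.sub_sub_self hlm] at this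
  have b1 : N ^ (m - l) ≤ m ^ (m - l) * (n - l).descFactorial (m - l) := by
    refine le_trans ?_ (Nat.mul_le_mul_left _ (Nat.pow_sub_le_descFactorial _ _))
    rw [← mul_pow]
    apply Nat.pow_le_pow_left
    obtain ⟨j, rfl⟩ := Nat.exists_eq_add_of_le hmn
    rw [show m + j - l + 1 - (m - l) = j + 1 by omega]
    have : j ≤ m * j := Nat.le_mul_of_pos_left j (by omega)
    rw [mul_add]
    omega
  have b2 : N ^ (m - l) ≤ (n + m).descFactorial (m - l) :=
    (Nat.pow_le_pow_left (by omega) _).trans (Nat.pow_sub_le_descFactorial _ _)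
  simp only [legendreEig]
  rw [← e1, ← e2, two_mul, pow_add]
  calc N ^ (m - l) * N ^ (m - l) * ((n + l).descFactorial l * n.descFactorial l)
      ≤ (m ^ (m - l) * (n - l).descFactorial (m - l)) * (n + m).descFactorial (m - l)
        * ((n + l).descFactorial l * n.descFactorial l) :=
        Nat.mul_le_mul_right _ (Nat.mul_le_mul b1 b2)
    _ = _ := by ring

lemma legendreEig_le {l m N n : ℕ} (hl : 1 ≤ l) (hlm : l ≤ m) (hm : m ≤ N + 1) (hn : N < n) :
    (legendreEig l n : ℝ)
      ≤ (m : ℝ) ^ (m - l) * ((N : ℝ) ^ ((l : ℤ) - (m : ℤ))) ^ 2 * legendreEig m n := by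
  have h1 : ((N ^ (2 * (m - l)) * legendreEig l n : ℕ) : ℝ)
      ≤ ((m ^ (m - l) * legendreEig m n : ℕ) : ℝ) :=
    Nat.cast_le.2 (pow_mul_legendreEig_le hl hlm hm hn)
  push_cast at h1
  have hz : (N : ℝ) ^ ((l : ℤ) - (m : ℤ)) = ((N : ℝ) ^ (m - l))⁻¹ := by
    rw [← zpow_natCast, ← zpow_neg]
    congr 1
    omega
  -- For `N = 0` the constraints force `l = m = 1`, so the power is `0^0 = 1`.
  have hpos : 0 < (N : ℝ) ^ (m - l) := by
    rcases Nat.eq_zero_or_pos N with rfl | hN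
    · rw [show m - l = 0 by omega]; simp
    · positivity
  rw [hz, inv_pow, ← pow_mul, mul_comm (m - l) 2, mul_assoc, mul_comm (_⁻¹), ← mul_assoc,
    ← div_eq_mul_inv, le_div_iff₀ (by rw [mul_comm, pow_mul]; positivity)]
  linarith

lemma IsScale.weightNorm_congr {ψ : ℝ → ℝ} {a b : ℝ} (h : IsScale ψ a b) {α β : ℝ} {f g : ℝ → ℝ}
    (hfg : f =ᵐ[volume.restrict (Ioo a b)] g) :
    weightNorm ψ a b α β f = weightNorm ψ a b α β g := by
  rw [weightNorm, weightNorm]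
  congr 1
  refine integral_congr_ae ?_
  filter_upwards [(h.ae_weightMeasure_iff α β).2 hfg] with x hx
  rw [hx]

end PsiSpectral

end

/-! ### The error estimate. -/

open PsiSpectral Polynomial Filter in
theorem theorem3p12 (a b : ℝ) (hab : a < b) (ψ : ℝ → ℝ)
    (hψ : ContDiffOn ℝ 1 ψ (Set.Icc a b))
    (hψ' : ∀ x ∈ Set.Icc a b, 0 < derivWithin ψ (Set.Icc a b) x)
    (ρ : ℝ) (hρ0 : 0 < ρ) (hρ1 : ρ < 1) (l m : ℕ) (hl : 1 ≤ l) (hlm : l ≤ m) :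
    ∃ C : ℝ, 0 < C ∧ ∀ N : ℕ, m ≤ N + 1 → ∀ u : ℝ → ℝ,
      MeasureTheory.MemLp u 2 (PsiSpectral.weightMeasure ψ a b ρ ρ) →
      PsiSpectral.psiIntegral ψ a ρ u ∈ PsiSpectral.SobolevB ψ a b m 0 0 →
      (∃! p : ℝ → ℝ, PsiSpectral.IsProjE ψ a b ρ N u p) ∧
      ∀ p : ℝ → ℝ, PsiSpectral.IsProjE ψ a b ρ N u p →
        (∃ g : ℝ → ℝ, PsiSpectral.IsPsiDeriv ψ a b ((l : ℝ) - ρ) (fun x => u x - p x) g) ∧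
        ∀ g h : ℝ → ℝ,
          PsiSpectral.IsPsiDeriv ψ a b ((l : ℝ) - ρ) (fun x => u x - p x) g →
          PsiSpectral.IsPsiDeriv ψ a b ((m : ℝ) - ρ) u h →
          MeasureTheory.MemLp g 2 (PsiSpectral.weightMeasure ψ a b l l) ∧
          PsiSpectral.weightNorm ψ a b l l g
            ≤ C * (N : ℝ) ^ ((l : ℤ) - (m : ℤ)) * PsiSpectral.weightNorm ψ a b m m h := by
  have hS : IsScale ψ a b := ⟨hab, hψ, hψ'⟩
  have hκ := hS.kappa_pos
  have hm : 1 ≤ m := hl.trans hlm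
  have hA : 0 < (m : ℝ) ^ (m - l) * (kappa ψ a b ^ (2 * l + 1) / kappa ψ a b ^ (2 * m + 1)) := by
    have : (0 : ℝ) < m := by exact_mod_cast hm
    positivity
  -- The factor `m^{m-l}` comes from the eigenvalues, and the powers of `κ` from the normalisation
  -- of `ϖ^{l,l}` and `ϖ^{m,m}`.
  refine ⟨Real.sqrt ((m : ℝ) ^ (m - l) * (kappa ψ a b ^ (2 * l + 1) / kappa ψ a b ^ (2 * m + 1))),
    Real.sqrt_pos.2 hA, fun N hN u hu hw => ⟨hS.existsUnique_isProjE hρ0 hρ1 N hu, fun p hp => ?_⟩⟩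
  obtain ⟨⟨q, hq, hqe⟩, horth⟩ := hS.psiIntegral_sub_isProjE hρ0 hρ1 hu hp
  -- The bound `k ≤ m` is moved under the existential, with the dummy value `0` beyond `m`, so that
  -- one sequence `w` can be chosen.
  have hw' : ∀ k : ℕ, ∃ g : ℝ → ℝ, k ≤ m → IsWeakDeltaPow ψ a b k (psiIntegral ψ a ρ u) g ∧
      MeasureTheory.MemLp g 2 (weightMeasure ψ a b k k) := fun k => by
    by_cases hk : k ≤ m
    · obtain ⟨g, hg1, hg2⟩ := hw k hk
      rw [zero_add] at hg2
      exact ⟨g, fun _ => ⟨hg1, hg2⟩⟩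
    · exact ⟨0, fun hc => absurd hc hk⟩
  choose w hw using hw'
  -- The Sobolev space provides each order separately, with its own intermediate derivatives;
  -- uniqueness of weak derivatives joins them into one chain.
  have hwd : ∀ i < m, IsWeakDelta ψ a b (w i) (w (i + 1)) := fun i hi => by
    obtain ⟨k, hk, hkw⟩ := (hw (i + 1) hi).1
    exact hkw.congr hS (IsWeakDeltaPow.ae_eq hS (ae_eq_refl _) hk (hw i hi.le).1) (ae_eq_refl _)
  let z : ℕ → ℝ → ℝ := fun i x => w i x - (derivative^[i] q).eval (ψ x)
  have hzd : ∀ i < l, IsWeakDelta ψ a b (z i) (z (i + 1)) := fun i hi =>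
    (hwd i (hi.trans_le hlm)).sub hS (hS.isWeakDelta_iterate_derivative q i)
  have hzL : ∀ i ≤ l, MeasureTheory.MemLp (z i) 2 (weightMeasure ψ a b i i) := fun i hi =>
    ((hw i (hi.trans hlm)).2).sub (hS.memLp_eval_natCast i _)
  have hw0 : psiIntegral ψ a ρ u =ᵐ[MeasureTheory.volume.restrict (Set.Ioo a b)] w 0 :=
    (hw 0 (Nat.zero_le _)).1
  have hz0 : psiIntegral ψ a ρ (fun x => u x - p x)
      =ᵐ[MeasureTheory.volume.restrict (Set.Ioo a b)] z 0 := by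
    filter_upwards [hqe, hw0] with x hx1 hx2
    rw [hx1, hx2]
    rfl
  have hzl := isWeakDeltaPow_of_chain hz0 hzd
  refine ⟨⟨z l, (isPsiDeriv_iff hρ0 hρ1 hl).2 hzl⟩, fun g v hg hv => ?_⟩
  have hgz := IsWeakDeltaPow.ae_eq hS (ae_eq_refl _) ((isPsiDeriv_iff hρ0 hρ1 hl).1 hg) hzl
  have hvw := IsWeakDeltaPow.ae_eq hS (ae_eq_refl _) ((isPsiDeriv_iff hρ0 hρ1 hm).1 hv)
    (hw m le_rfl).1
  refine ⟨(hzL l le_rfl).ae_eq ((hS.ae_weightMeasure_iff _ _).2 (hgz.mono fun x hx => hx.symm)), ?_⟩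
  rw [hS.weightNorm_congr hgz, hS.weightNorm_congr hvw]
  have hmain := hS.weightNorm_chain_le (N := N) (m := m) hzd hzL hwd (fun i hi => (hw i hi).2) hq
    (Eventually.of_forall fun x => rfl) (fun Q hQ => by
      rw [← horth Q hQ]
      refine MeasureTheory.integral_congr_ae ?_
      filter_upwards [hz0] with x hx
      rw [hx])
    -- `K` is chosen as the square of the desired factor, since the estimate returns its square
    -- root.
    (K := (Real.sqrt ((m : ℝ) ^ (m - l)
      * (kappa ψ a b ^ (2 * l + 1) / kappa ψ a b ^ (2 * m + 1)))
      * (N : ℝ) ^ ((l : ℤ) - (m : ℤ))) ^ 2) (sq_nonneg _) (fun n hn => by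
      rw [mul_pow, Real.sq_sqrt hA.le]
      have h1 := mul_le_mul_of_nonneg_left (legendreEig_le hl hlm hN hn)
        (pow_pos hκ (2 * l + 1)).le
      refine h1.trans (le_of_eq ?_)
      have := (pow_pos hκ (2 * m + 1)).ne'
      field_simp)
  rwa [Real.sqrt_sq (by positivity)] at hmain
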